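/- Let $n,d\ge 1$ and let $G$ be a real symmetric $n\times n$ matrix with nonnegative entries and $\sum_{i,j}G_{i,j}=1$. Put $\pi_j:=\sum_i G_{i,j}$ and $A_{i,j}:=G_{i,j}/\pi_j$ (with $A_{i,j}:=0$ if $\pi_j=0$), and $$\varepsilon:=14\left(d^4\,\ln(d)\,\operatorname{tr}[A^2]\,\|\pi\|_2^2\right)^{1/8}+\|\pi\|_2^2,\qquad \|\pi\|_2^2=\sum_j\pi_j^2 .$$ For an operator $\rho$ on $(\mathbb C^d)^{\otimes n}$ let $\rho^{Q_iQ_j}$ be its marginal on the sites in $\{i,j\}$ (the partial trace over all other sites; for $i=j$ this is the one-site marginal), and let $\|X\|_1=\operatorname{tr}\sqrt{X^\dagger X}$. A state (positive semidefinite operator of trace one) $\sigma$ on $(\mathbb C^d)^{\otimes n}$ is called globally separable if $\sigma=\sum_z p_z\,\sigma_z^{1}\otimes\cdots\otimes\sigma_z^{n}$ for a finite probability distribution $(p_z)$ and states $\sigma_z^{k}$ on $\mathbb C^d$. (1) For every state $\rho$ on $(\mathbb C^d)^{\otimes n}$ there is a globally separable state $\sigma$ with $$\sum_{i,j}G_{i,j}\,\bigl\|\rho^{Q_iQ_j}-\sigma^{Q_iQ_j}\bigr\|_1\le\varepsilon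 .$$ (2) Let $H=\sum_{i,j}G_{i,j}H_{i,j}$, where each $H_{i,j}$ is a Hermitian operator on $(\mathbb C^d)^{\otimes n}$ that acts only on the sites $i,j$ (as the identity on all others) and has operator norm $\|H_{i,j}\|\le 1$. Then there are unit vectors $|\varphi_1\rangle,\dots,|\varphi_n\rangle\in\mathbb C^d$ such that $|\varphi\rangle=|\varphi_1\rangle\otimes\cdots\otimes|\varphi_n\rangle$ satisfies $$\langle\varphi|H|\varphi\rangle\le e_0(H)+\varepsilon,\qquad e_0(H):=\min\{\langle\psi|H|\psi\rangle:\langle\psi|\psi\rangle=1\}.$$ -/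

import Mathlib

open scoped ComplexOrder

noncomputable section

namespace ProductApprox

/-- Computational basis labels of the qudits (of local dimension `d`) located at the sites in `S`. -/
abbrev Config {n : ℕ} (d : ℕ) (S : Finset (Fin n)) : Type := {k : Fin n // k ∈ S} → Fin d

/-- Operators on `(ℂ^d)^{⊗ n}`, as matrices in the computational basis. -/
abbrev Op (n d : ℕ) : Type := Matrix (Fin n → Fin d) (Fin n → Fin d) ℂ

/-- Quantum states: positive semidefinite matrices of unit trace. -/
def IsDensity {ι : Type*} [Fintype ι] (ρ : Matrix ι ι ℂ) : Prop :=
  ρ.PosSemidef ∧ ρ.trace = 1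

/-- The trace norm `tr √(X† X)`: the square roots of the eigenvalues of `X† X` are summed. -/
def traceNorm {ι : Type*} [Fintype ι] [DecidableEq ι] (X : Matrix ι ι ℂ) : ℝ :=
  ∑ i, Real.sqrt ((Matrix.isHermitian_conjTranspose_mul_self X).eigenvalues i)

/-- The operator norm (largest singular value), for the Euclidean norm on vectors. -/
def opNorm {ι : Type*} [Fintype ι] [DecidableEq ι] (X : Matrix ι ι ℂ) : ℝ :=
  ‖Matrix.toEuclideanCLM (n := ι) (𝕜 := ℂ) X‖

/-- The basis label of all `n` sites that is `x` on `S` and `z` off `S`. -/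
def glue {n d : ℕ} (S : Finset (Fin n)) (x : Config d S) (z : {k : Fin n // k ∉ S} → Fin d) :
    Fin n → Fin d :=
  fun k => if h : k ∈ S then x ⟨k, h⟩ else z ⟨k, h⟩

/-- The marginal `ρ^{Q_S}`: the partial trace of `ρ` over all sites outside `S`. -/
def marginal {n d : ℕ} (S : Finset (Fin n)) (ρ : Op n d) :
    Matrix (Config d S) (Config d S) ℂ :=
  Matrix.of fun x y => ∑ z : {k : Fin n // k ∉ S} → Fin d, ρ (glue S x z) (glue S y z)

/-- The operator `h ⊗ I` on all `n` sites, for an operator `h` on the sites in `S`. -/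
def extend {n d : ℕ} (S : Finset (Fin n)) (h : Matrix (Config d S) (Config d S) ℂ) : Op n d :=
  Matrix.of fun x y =>
    if ∀ k, k ∉ S → x k = y k then h (fun k => x k.1) (fun k => y k.1) else 0

/-- `M` acts only on the sites in `S`. -/
def ActsOnlyOn {n d : ℕ} (S : Finset (Fin n)) (M : Op n d) : Prop :=
  ∃ h : Matrix (Config d S) (Config d S) ℂ, M = extend S h

/-- The tensor product `s 0 ⊗ ⋯ ⊗ s (n - 1)` of single-site operators. -/
def tensorOp {n d : ℕ} (s : Fin n → Matrix (Fin d) (Fin d) ℂ) : Op n d :=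
  Matrix.of fun x y => ∏ k, s k (x k) (y k)

/-- The tensor product `φ 0 ⊗ ⋯ ⊗ φ (n - 1)` of single-site vectors. -/
def tensorVec {n d : ℕ} (φ : Fin n → EuclideanSpace ℂ (Fin d)) : (Fin n → Fin d) → ℂ :=
  fun x => ∏ k, φ k (x k)

/-- The projector `|ψ⟩⟨ψ|`. -/
def proj {ι : Type*} (ψ : ι → ℂ) : Matrix ι ι ℂ := Matrix.vecMulVec ψ (star ψ)

/-- Globally separable states: finite convex combinations `∑ p_z σ_z` of product states. -/
def GloballySeparable {n d : ℕ} (σ : Op n d) : Prop :=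
  ∃ (m : ℕ) (p : Fin m → ℝ) (s : Fin m → Fin n → Matrix (Fin d) (Fin d) ℂ),
    (∀ z, 0 ≤ p z) ∧ ∑ z, p z = 1 ∧ (∀ z k, IsDensity (s z k)) ∧
      σ = ∑ z, (p z : ℂ) • tensorOp (s z)

/-- The ground-state energy `e₀(H) = min {⟨ψ|H|ψ⟩ : ⟨ψ|ψ⟩ = 1}` of a Hermitian `H`. -/
def groundEnergy {ι : Type*} [Fintype ι] (H : Matrix ι ι ℂ) : ℝ :=
  sInf {e : ℝ | ∃ ψ : ι → ℂ, star ψ ⬝ᵥ ψ = 1 ∧ e = (star ψ ⬝ᵥ H.mulVec ψ).re}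

/-- The vector `π_j = ∑ i, G i j`. -/
def stationary {n : ℕ} (G : Matrix (Fin n) (Fin n) ℝ) (j : Fin n) : ℝ := ∑ i, G i j

/-- The random walk matrix `A i j = G i j / π_j`; a column with `π_j = 0` (then also
`G i j = 0` for all `i`) is zero. -/
def walkMatrix {n : ℕ} (G : Matrix (Fin n) (Fin n) ℝ) : Matrix (Fin n) (Fin n) ℝ :=
  Matrix.of fun i j => G i j / stationary G j

/-- The error `14 (d⁴ ln d tr[A²] ‖π‖₂²)^{1/8} + ‖π‖₂²`. -/
def errorBound {n : ℕ} (d : ℕ) (G : Matrix (Fin n) (Fin n) ℝ) : ℝ :=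
  14 * ((d : ℝ) ^ 4 * Real.log d * (walkMatrix G * walkMatrix G).trace *
      ∑ j, stationary G j ^ 2) ^ (1 / 8 : ℝ) + ∑ j, stationary G j ^ 2

end ProductApprox

end

/-! Measure a set `C` of sites with an informationally complete measurement, and replace the state
by the mixture, over outcomes, of products of the conditional one-site states (`rounded`). On a pair
outside `C`, the error is the averaged correlation left after conditioning. It remains to find a `C`
of small `π`-weight that leaves little correlation.

Correlation is tracked by a quadratic potential instead of an entropy: the mean square of the
outcome density at `i` given the outcomes in `C`. Every effect is at most `2d`, so this potential
lies in `[0, 2d]`. It grows with `C`, and adding `j` raises it by at least `1/(2d)` times the mean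
squared covariance of the outcomes at `i` and `j` (`expect_covariance_le`). Minimizing `2dμ π(C)`
minus the `π`-averaged potential over all `C` gives `π(C) ≤ 1/μ` and a bound on the average
increment (`exists_conditioning_set`). The measurement's frame bound turns outcome covariances into
matrix entries, hence trace norms (`traceNorm_marginal_sub_rounded_sq_le`). Cauchy–Schwarz passes
from weights `π_i π_j` to `G`, at the cost of `tr[A²]` (`sq_sum_mul_le_trace`).

Pairs meeting `C` cost at most `2` each, so the total is `4 √(tμ) + 4/μ` with `t = d⁴ tr[A²] ‖π‖²`.
The choice `μ = t^(-1/8)` gives at most `8 t^(1/8)` when `t < 1`.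

For the Hamiltonian, the separable state is built from a ground state. Trace-norm duality bounds the
energy change, and averaging over the mixture and over eigenbases of its factors yields a product
vector. -/

namespace ProductApprox

/-! ### Trace norm and spectral decomposition. -/

section TraceNorm

open Matrix

variable {ι : Type*} [Fintype ι] [DecidableEq ι]

theorem eq_sum_eigenvalues_smul_proj {X : Matrix ι ι ℂ} (hX : X.IsHermitian) :
    X = ∑ i, (hX.eigenvalues i : ℂ) • proj (hX.eigenvectorBasis i).ofLp := by
  conv_lhs => rw [hX.spectral_theorem, Unitary.conjStarAlgAut_apply]
  ext a b
  simp only [mul_apply, diagonal_apply, Matrix.sum_apply, Matrix.smul_apply, proj, vecMulVec_apply]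
  refine Finset.sum_congr rfl fun i _ => ?_
  simp [Matrix.star_apply]
  ring

theorem sum_proj_eigenvectorBasis {X : Matrix ι ι ℂ} (hX : X.IsHermitian) :
    ∑ i, proj (hX.eigenvectorBasis i).ofLp = 1 := by
  have h := Unitary.coe_mul_star_self hX.eigenvectorUnitary
  rw [← h]
  ext a b
  simp [mul_apply, Matrix.sum_apply, proj, vecMulVec_apply, Matrix.star_apply]

theorem trace_mul_proj {ι : Type*} [Fintype ι] (A : Matrix ι ι ℂ) (v : ι → ℂ) :
    (A * proj v).trace = star v ⬝ᵥ A *ᵥ v := by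
  rw [proj, mul_vecMulVec, trace_vecMulVec, dotProduct_comm]

/-- The eigenvalue families of `Xᴴ * X` and of `X` are indexed independently, so they are compared
as multisets of roots of one characteristic polynomial. -/
theorem traceNorm_eq_sum_abs_eigenvalues {X : Matrix ι ι ℂ} (hX : X.IsHermitian) :
    traceNorm X = ∑ i, |hX.eigenvalues i| := by
  have h1 : (Xᴴ * X).charpoly.roots =
      Multiset.map (fun i => ((hX.eigenvalues i ^ 2 : ℝ) : ℂ)) Finset.univ.val := by
    have h2 : Xᴴ * X = (hX.eigenvectorUnitary : Matrix ι ι ℂ) *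
        diagonal (fun i => ((hX.eigenvalues i ^ 2 : ℝ) : ℂ)) *
          star (hX.eigenvectorUnitary : Matrix ι ι ℂ) := by
      rw [hX.eq]
      conv_lhs => rw [hX.spectral_theorem, ← map_mul, diagonal_mul_diagonal,
        Unitary.conjStarAlgAut_apply]
      congr 3
      ext i
      simp [pow_two]
    rw [h2, charpoly_mul_comm, ← mul_assoc, Unitary.coe_star_mul_self, one_mul,
      charpoly_diagonal, Polynomial.roots_prod]
    · simp [-Complex.ofReal_pow]
    · simp [-Complex.ofReal_pow, Finset.prod_ne_zero_iff, Polynomial.X_sub_C_ne_zero]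
  have h3 := (isHermitian_conjTranspose_mul_self X).roots_charpoly_eq_eigenvalues
  rw [h1] at h3
  have h4 := congrArg (fun s : Multiset ℂ => (s.map fun c => Real.sqrt c.re).sum) h3
  simp only [Multiset.map_map, Function.comp_def, Complex.ofReal_re, Real.sqrt_sq_eq_abs] at h4
  exact h4.symm

/-- Cauchy–Schwarz over the singular values, whose squares sum to `tr (Xᴴ * X)`. -/
theorem traceNorm_sq_le (X : Matrix ι ι ℂ) :
    traceNorm X ^ 2 ≤ Fintype.card ι * ∑ a, ∑ b, ‖X a b‖ ^ 2 := by
  have hpos := (posSemidef_conjTranspose_mul_self X).eigenvalues_nonneg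
  have h1 : ∑ i, (isHermitian_conjTranspose_mul_self X).eigenvalues i =
      ∑ a, ∑ b, ‖X a b‖ ^ 2 := by
    have h2 := (isHermitian_conjTranspose_mul_self X).trace_eq_sum_eigenvalues
    have h3 : (Xᴴ * X).trace = ((∑ a, ∑ b, ‖X a b‖ ^ 2 : ℝ) : ℂ) := by
      rw [Finset.sum_comm]
      simp only [trace, diag_apply, mul_apply, conjTranspose_apply]
      push_cast
      refine Finset.sum_congr rfl fun i _ => Finset.sum_congr rfl fun j _ => ?_
      exact Complex.conj_mul' _
    rw [h3] at h2
    refine (Complex.ofReal_injective (h2.trans ?_)).symm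
    push_cast
    rfl
  rw [← h1]
  refine (sq_sum_le_card_mul_sum_sq (s := Finset.univ)).trans_eq ?_
  rw [Finset.card_univ]
  congr 1
  exact Finset.sum_congr rfl fun i _ => Real.sq_sqrt (hpos i)

theorem traceNorm_sub_le_two {ρ σ : Matrix ι ι ℂ} (hρ : IsDensity ρ) (hσ : IsDensity σ) :
    traceNorm (ρ - σ) ≤ 2 := by
  have hX : (ρ - σ).IsHermitian := hρ.1.isHermitian.sub hσ.1.isHermitian
  have key : ∀ τ : Matrix ι ι ℂ, IsDensity τ →
      ∑ i, (star (hX.eigenvectorBasis i).ofLp ⬝ᵥ τ *ᵥ (hX.eigenvectorBasis i).ofLp).re = 1 := by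
    intro τ hτ
    simp_rw [← trace_mul_proj]
    rw [← Complex.re_sum, ← trace_sum, ← Finset.mul_sum, sum_proj_eigenvectorBasis, mul_one,
      hτ.2, Complex.one_re]
  rw [traceNorm_eq_sum_abs_eigenvalues hX]
  calc ∑ i, |hX.eigenvalues i|
      ≤ ∑ i, ((star (hX.eigenvectorBasis i).ofLp ⬝ᵥ ρ *ᵥ (hX.eigenvectorBasis i).ofLp).re +
        (star (hX.eigenvectorBasis i).ofLp ⬝ᵥ σ *ᵥ (hX.eigenvectorBasis i).ofLp).re) := by
        refine Finset.sum_le_sum fun i _ => ?_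
        have h1 := hρ.1.dotProduct_mulVec_nonneg (hX.eigenvectorBasis i).ofLp
        have h2 := hσ.1.dotProduct_mulVec_nonneg (hX.eigenvectorBasis i).ofLp
        have h3 := (Complex.le_def.1 h1).1
        have h4 := (Complex.le_def.1 h2).1
        have h5 := hX.eigenvalues_eq i
        rw [sub_mulVec, dotProduct_sub] at h5
        simp only [Complex.zero_re] at h3 h4
        rw [h5, abs_le]
        simp only [RCLike.re_to_complex, Complex.sub_re]
        constructor <;> linarith
    _ = 2 := by rw [Finset.sum_add_distrib, key ρ hρ, key σ hσ]; norm_num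

theorem re_trace_mul_proj_abs_le (A : Matrix ι ι ℂ) (v : EuclideanSpace ℂ ι) (hv : ‖v‖ = 1) :
    |(A * proj v.ofLp).trace.re| ≤ opNorm A := by
  rw [trace_mul_proj]
  have h : star v.ofLp ⬝ᵥ A *ᵥ v.ofLp = inner ℂ v (toEuclideanCLM (n := ι) (𝕜 := ℂ) A v) := by
    rw [EuclideanSpace.inner_eq_star_dotProduct, dotProduct_comm]
    rfl
  rw [h]
  refine (Complex.abs_re_le_norm _).trans ((norm_inner_le_norm _ _).trans ?_)
  rw [hv, one_mul]
  exact (ContinuousLinearMap.le_opNorm _ _).trans_eq (by rw [hv, mul_one]; rfl)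

/-- Expand `X` in its eigenprojectors. Only rank-one bounds on `A` are assumed, because a local
operator will be controlled solely through its extension to all sites. -/
theorem re_trace_mul_abs_le {A X : Matrix ι ι ℂ} (hX : X.IsHermitian) {K : ℝ}
    (hA : ∀ v : EuclideanSpace ℂ ι, ‖v‖ = 1 → |(A * proj v.ofLp).trace.re| ≤ K) :
    |(A * X).trace.re| ≤ K * traceNorm X := by
  rw [traceNorm_eq_sum_abs_eigenvalues hX]
  conv_lhs => rw [eq_sum_eigenvalues_smul_proj hX]
  rw [Finset.mul_sum, trace_sum, Complex.re_sum, Finset.mul_sum]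
  refine (Finset.abs_sum_le_sum_abs _ _).trans (Finset.sum_le_sum fun i _ => ?_)
  rw [Matrix.mul_smul, trace_smul, smul_eq_mul, Complex.re_ofReal_mul, abs_mul, mul_comm]
  exact mul_le_mul_of_nonneg_right
    (hA _ (hX.eigenvectorBasis.orthonormal.1 i)) (abs_nonneg _)

end TraceNorm

/-! ### Product operators, pairings and marginals. -/

section Tensor

open Matrix

variable {n d : ℕ}

theorem tensorOp_mul (a b : Fin n → Matrix (Fin d) (Fin d) ℂ) :
    tensorOp a * tensorOp b = tensorOp fun k => a k * b k := by
  ext x y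
  simp only [mul_apply, tensorOp, of_apply, Finset.prod_univ_sum, Fintype.piFinset_univ,
    Finset.prod_mul_distrib]

theorem conjTranspose_tensorOp (a : Fin n → Matrix (Fin d) (Fin d) ℂ) :
    (tensorOp a)ᴴ = tensorOp fun k => (a k)ᴴ := by
  ext x y
  simp [tensorOp, conjTranspose_apply]

theorem trace_tensorOp (a : Fin n → Matrix (Fin d) (Fin d) ℂ) :
    (tensorOp a).trace = ∏ k, (a k).trace := by
  simp only [trace, diag_apply, tensorOp, of_apply, Finset.prod_univ_sum, Fintype.piFinset_univ]

theorem tensorOp_one : tensorOp (fun _ => 1 : Fin n → Matrix (Fin d) (Fin d) ℂ) = 1 := by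
  ext x y
  by_cases h : x = y
  · subst h
    simp [tensorOp]
  · obtain ⟨k, hk⟩ := Function.ne_iff.1 h
    rw [one_apply_ne h]
    exact Finset.prod_eq_zero (Finset.mem_univ k) (one_apply_ne hk)

open scoped MatrixOrder Matrix.Norms.L2Operator in
theorem exists_eq_conjTranspose_mul_self {ι : Type*} [Fintype ι] [DecidableEq ι]
    {A : Matrix ι ι ℂ} (hA : A.PosSemidef) : ∃ B : Matrix ι ι ℂ, A = Bᴴ * B :=
  CStarAlgebra.nonneg_iff_eq_star_mul_self.mp hA.nonneg

theorem tensorOp_posSemidef {a : Fin n → Matrix (Fin d) (Fin d) ℂ} (ha : ∀ k, (a k).PosSemidef) :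
    (tensorOp a).PosSemidef := by
  have h : ∀ k, ∃ B : Matrix (Fin d) (Fin d) ℂ, a k = Bᴴ * B := fun k =>
    exists_eq_conjTranspose_mul_self (ha k)
  choose B hB using h
  have : tensorOp a = (tensorOp B)ᴴ * tensorOp B := by
    rw [conjTranspose_tensorOp, tensorOp_mul]
    congr 1
    funext k
    exact hB k
  rw [this]
  exact posSemidef_conjTranspose_mul_self _

theorem tensorOp_isDensity {a : Fin n → Matrix (Fin d) (Fin d) ℂ} (ha : ∀ k, IsDensity (a k)) :
    IsDensity (tensorOp a) :=
  ⟨tensorOp_posSemidef fun k => (ha k).1, by simp [trace_tensorOp, (ha _).2]⟩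

theorem trace_mul_nonneg {ι : Type*} [Fintype ι] [DecidableEq ι] {A B : Matrix ι ι ℂ}
    (hA : A.PosSemidef) (hB : B.PosSemidef) : 0 ≤ (A * B).trace := by
  obtain ⟨D, rfl⟩ := exists_eq_conjTranspose_mul_self hB
  rw [← mul_assoc, trace_mul_comm, ← mul_assoc]
  exact (hA.mul_mul_conjTranspose_same D).trace_nonneg

/-- The expectation of the product observable `a 0 ⊗ ⋯ ⊗ a (n - 1)` in `ρ`. -/
def pairing (ρ : Op n d) (a : Fin n → Matrix (Fin d) (Fin d) ℂ) : ℂ := (ρ * tensorOp a).trace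

theorem pairing_nonneg {ρ : Op n d} (hρ : ρ.PosSemidef) {a : Fin n → Matrix (Fin d) (Fin d) ℂ}
    (ha : ∀ k, (a k).PosSemidef) : 0 ≤ pairing ρ a :=
  trace_mul_nonneg hρ (tensorOp_posSemidef ha)

theorem pairing_tensorOp (s a : Fin n → Matrix (Fin d) (Fin d) ℂ) :
    pairing (tensorOp s) a = ∏ k, (s k * a k).trace := by
  rw [pairing, tensorOp_mul, trace_tensorOp]

theorem pairing_sum_smul {κ : Type*} (s : Finset κ) (c : κ → ℂ) (ρ : κ → Op n d)
    (a : Fin n → Matrix (Fin d) (Fin d) ℂ) :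
    pairing (∑ z ∈ s, c z • ρ z) a = ∑ z ∈ s, c z * pairing (ρ z) a := by
  simp [pairing, Finset.sum_mul, trace_sum]

/-- The operator at site `i` obtained from `ρ` by evaluating `a` at all other sites. -/
def reduced (ρ : Op n d) (a : Fin n → Matrix (Fin d) (Fin d) ℂ) (i : Fin n) :
    Matrix (Fin d) (Fin d) ℂ :=
  Matrix.of fun u v => pairing ρ (Function.update a i (single v u 1))

theorem tensorOp_update_apply (a : Fin n → Matrix (Fin d) (Fin d) ℂ) (i : Fin n)
    (B : Matrix (Fin d) (Fin d) ℂ) (x y : Fin n → Fin d) :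
    tensorOp (Function.update a i B) x y =
      B (x i) (y i) * ∏ k ∈ Finset.univ.erase i, a k (x k) (y k) := by
  rw [tensorOp, of_apply, ← Finset.mul_prod_erase _ _ (Finset.mem_univ i), Function.update_self]
  congr 1
  refine Finset.prod_congr rfl fun k hk => ?_
  rw [Function.update_of_ne (Finset.ne_of_mem_erase hk)]

/-- Expand `B` in matrix units. This makes linearity in one factor available as linearity of a
trace. -/
theorem pairing_update (ρ : Op n d) (a : Fin n → Matrix (Fin d) (Fin d) ℂ) (i : Fin n)
    (B : Matrix (Fin d) (Fin d) ℂ) :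
    pairing ρ (Function.update a i B) = (reduced ρ a i * B).trace := by
  have h : tensorOp (Function.update a i B) =
      ∑ u, ∑ v, B v u • tensorOp (Function.update a i (single v u 1)) := by
    ext x y
    simp [Matrix.sum_apply, tensorOp_update_apply, single_apply, ite_and, Finset.sum_ite_eq']
  rw [pairing, h]
  simp only [Finset.mul_sum, trace_sum, Matrix.mul_smul, trace_smul, smul_eq_mul]
  simp only [trace, diag_apply, mul_apply, reduced, of_apply, pairing]
  exact Finset.sum_congr rfl fun u _ => Finset.sum_congr rfl fun v _ => mul_comm _ _

theorem sum_eq_sum_glue {M : Type*} [AddCommMonoid M] (S : Finset (Fin n))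
    (f : (Fin n → Fin d) → M) : ∑ x, f x = ∑ u, ∑ z, f (glue S u z) := by
  rw [← Fintype.sum_prod_type' (f := fun u z => f (glue S u z))]
  exact (Equiv.sum_comp (Equiv.piEquivPiSubtypeProd (fun k => k ∈ S) fun _ => Fin d).symm f).symm

theorem extend_glue (S : Finset (Fin n)) (h : Matrix (Config d S) (Config d S) ℂ)
    (u v : Config d S) (z w : {k : Fin n // k ∉ S} → Fin d) :
    extend S h (glue S u z) (glue S v w) = if z = w then h u v else 0 := by
  have h1 : (∀ k, k ∉ S → glue S u z k = glue S v w k) ↔ z = w := by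
    constructor
    · intro hk
      funext ⟨k, hS⟩
      simpa [glue, hS] using hk k hS
    · rintro rfl k hS
      simp [glue, hS]
  simp only [extend, of_apply, h1]
  simp [glue]

/-- Partial trace is dual to tensoring with the identity. Both the entries of a marginal and the
energy of a local term are read off through this duality. -/
theorem trace_mul_extend (S : Finset (Fin n)) (ρ : Op n d)
    (h : Matrix (Config d S) (Config d S) ℂ) :
    (ρ * extend S h).trace = (marginal S ρ * h).trace := by
  simp only [trace, diag_apply, mul_apply, marginal, of_apply]
  rw [sum_eq_sum_glue S]
  simp_rw [sum_eq_sum_glue S (M := ℂ) (d := d), extend_glue]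
  refine Finset.sum_congr rfl fun u _ => ?_
  rw [Finset.sum_comm]
  refine Finset.sum_congr rfl fun v _ => ?_
  simp [Finset.sum_mul]

theorem extend_one (S : Finset (Fin n)) : extend S (1 : Matrix (Config d S) (Config d S) ℂ) = 1 := by
  ext x y
  simp only [extend, of_apply, one_apply]
  have h : x = y ↔ (∀ k, k ∉ S → x k = y k) ∧
      ((fun k : {k // k ∈ S} => x k.1) = fun k => y k.1) := by
    constructor
    · rintro rfl
      simp
    · rintro ⟨h1, h2⟩
      funext k
      by_cases hk : k ∈ S
      · exact congrFun h2 ⟨k, hk⟩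
      · exact h1 k hk
  simp only [h, ite_and]

theorem marginal_isDensity (S : Finset (Fin n)) {ρ : Op n d} (hρ : IsDensity ρ) :
    IsDensity (marginal S ρ) := by
  constructor
  · have h : marginal S ρ = ∑ z, ρ.submatrix (fun u => glue S u z) fun u => glue S u z := by
      ext u v
      simp [marginal, Matrix.sum_apply]
    rw [h]
    exact posSemidef_sum _ fun z _ => hρ.1.submatrix _
  · have h := trace_mul_extend S ρ 1
    rw [extend_one, mul_one, mul_one] at h
    rw [← h, hρ.2]

theorem extend_single (S : Finset (Fin n)) (u v : Config d S) :
    extend S (single u v 1) =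
      tensorOp fun k => if h : k ∈ S then single (u ⟨k, h⟩) (v ⟨k, h⟩) 1 else 1 := by
  ext x y
  simp only [extend, tensorOp, of_apply, single_apply]
  rw [← Fintype.prod_subtype_mul_prod_subtype (fun k => k ∈ S)]
  have h1 : ∀ k : {k // k ∈ S}, (if h : k.1 ∈ S then single (u ⟨k.1, h⟩) (v ⟨k.1, h⟩) (1 : ℂ)
      else 1) (x k.1) (y k.1) = if u k = x k.1 ∧ v k = y k.1 then 1 else 0 := fun k => by
    simp [single_apply]
  have h2 : ∀ k : {k // k ∉ S}, (if h : k.1 ∈ S then single (u ⟨k.1, h⟩) (v ⟨k.1, h⟩) (1 : ℂ)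
      else 1) (x k.1) (y k.1) = if x k.1 = y k.1 then 1 else 0 := fun k => by
    simp [one_apply, k.2]
  simp only [h1, h2, Fintype.prod_ite_zero, Finset.prod_const_one, funext_iff, forall_and,
    Subtype.forall]
  split_ifs <;> simp_all

theorem marginal_apply (S : Finset (Fin n)) (ρ : Op n d) (u v : Config d S) :
    marginal S ρ u v =
      pairing ρ fun k => if h : k ∈ S then single (v ⟨k, h⟩) (u ⟨k, h⟩) 1 else 1 := by
  rw [pairing, ← extend_single, trace_mul_extend]
  simp [trace_mul_single]

theorem marginal_pair_apply {i j : Fin n} (hij : i ≠ j) (ρ : Op n d) (u v : Config d {i, j}) :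
    marginal {i, j} ρ u v = pairing ρ (Function.update (Function.update (fun _ => 1) i
      (single (v ⟨i, by simp⟩) (u ⟨i, by simp⟩) 1)) j
        (single (v ⟨j, by simp⟩) (u ⟨j, by simp⟩) 1)) := by
  rw [marginal_apply]
  congr 1
  funext k
  by_cases hj : k = j
  · subst hj
    simp
  · by_cases hi : k = i
    · subst hi
      simp [hij]
    · simp [hi, hj]

theorem marginal_diag_apply (i : Fin n) (ρ : Op n d) (u v : Config d {i, i}) :
    marginal {i, i} ρ u v = pairing ρ (Function.update (fun _ => 1) i
      (single (v ⟨i, by simp⟩) (u ⟨i, by simp⟩) 1)) := by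
  rw [marginal_apply]
  congr 1
  funext k
  by_cases hi : k = i
  · subst hi
    simp
  · simp [hi]

end Tensor

end ProductApprox

noncomputable section

namespace ProductApprox

open Matrix Finset
open scoped BigOperators

variable {n d : ℕ}

/-! ### An informationally complete measurement and its frame bound. -/

/-- The fourth roots of unity. -/
def phase : Fin 4 → ℂ := ![1, Complex.I, -1, -Complex.I]

theorem phase_mul_star (z : Fin 4) : phase z * star (phase z) = 1 := by
  fin_cases z <;> simp [phase]

/-- The unnormalized vector `e_a + ω e_b`, for basis labels `a`, `b` and a fourth root of
unity `ω`. -/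
def probe (y : Fin d × Fin d × Fin 4) : Fin d → ℂ :=
  Pi.single y.1 1 + phase y.2.2 • Pi.single y.2.1 1

/-- The rescaled effects of an informationally complete measurement: the uniform average of all of
them is the identity. -/
def effect (y : Fin d × Fin d × Fin 4) : Matrix (Fin d) (Fin d) ℂ :=
  (d / 2 : ℂ) • proj (probe y)

theorem proj_single_add (a b : Fin d) (c : ℂ) :
    proj (Pi.single a 1 + c • Pi.single b 1 : Fin d → ℂ) =
      single a a 1 + (c * star c) • single b b 1 + star c • single a b 1 + c • single b a 1 := by
  have h : ∀ a b : Fin d, vecMulVec (Pi.single a 1 : Fin d → ℂ) (Pi.single b 1) = single a b 1 := by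
    intro a b
    ext u v
    simp only [vecMulVec_apply, Pi.single_apply, single_apply, ite_and, eq_comm (a := u),
      eq_comm (a := v)]
    split_ifs <;> simp
  simp only [proj, star_add, star_smul, Pi.star_single, star_one, vecMulVec_add, add_vecMulVec,
    smul_vecMulVec, vecMulVec_smul, h]
  module

theorem effect_eq (y : Fin d × Fin d × Fin 4) :
    effect y = (d / 2 : ℂ) • (single y.1 y.1 1 + single y.2.1 y.2.1 1 +
      star (phase y.2.2) • single y.1 y.2.1 1 + phase y.2.2 • single y.2.1 y.1 1) := by
  rw [effect, probe, proj_single_add, phase_mul_star, one_smul]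

theorem sum_single_diag : ∑ a, single a a (1 : ℂ) = (1 : Matrix (Fin d) (Fin d) ℂ) := by
  ext u v
  simp [Matrix.sum_apply, single_apply, one_apply, ite_and]

theorem sum_effect :
    ∑ y : Fin d × Fin d × Fin 4, effect y =
      (Fintype.card (Fin d × Fin d × Fin 4) : ℂ) • (1 : Matrix (Fin d) (Fin d) ℂ) := by
  have h1 : ∑ z, phase z = 0 := by simp [Fin.sum_univ_four, phase]
  have h2 : ∑ z, star (phase z) = 0 := by rw [← star_sum, h1, star_zero]
  simp only [effect_eq, Fintype.sum_prod_type, ← smul_sum, sum_add_distrib, ← sum_smul, h1, h2,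
    zero_smul, sum_const_zero, sum_const, card_univ, sum_single_diag, Fintype.card_prod,
    Fintype.card_fin, ← Nat.cast_smul_eq_nsmul ℂ, smul_smul, ← add_smul, add_zero]
  congr 1
  push_cast
  ring

theorem effect_posSemidef (y : Fin d × Fin d × Fin 4) : (effect y).PosSemidef :=
  (posSemidef_vecMulVec_self_star _).smul (by positivity)

theorem one_sub_single_posSemidef (a : Fin d) :
    (1 - single a a 1 : Matrix (Fin d) (Fin d) ℂ).PosSemidef := by
  have h : (1 - single a a 1 : Matrix (Fin d) (Fin d) ℂ) =
      diagonal fun u => if a = u then 0 else 1 := by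
    ext u v
    by_cases huv : u = v <;> by_cases hau : a = u <;> simp_all [one_apply]
  rw [h]
  refine PosSemidef.diagonal fun u => ?_
  simp only [Pi.zero_apply]
  split_ifs <;> norm_num

/-- The projectors of `e_a + ω e_b` and `e_a - ω e_b` add up to `2 (E_aa + E_bb)`, which is at most
`4`. -/
theorem effect_le (y : Fin d × Fin d × Fin 4) :
    ((2 * d : ℂ) • (1 : Matrix (Fin d) (Fin d) ℂ) - effect y).PosSemidef := by
  have h : (2 * d : ℂ) • (1 : Matrix (Fin d) (Fin d) ℂ) - effect y =
      (d / 2 : ℂ) • (proj (Pi.single y.1 1 + (-phase y.2.2) • Pi.single y.2.1 1) +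
        ((2 : ℂ) • (1 - single y.1 y.1 1) + (2 : ℂ) • (1 - single y.2.1 y.2.1 1))) := by
    rw [effect_eq, proj_single_add, star_neg, neg_mul_neg, phase_mul_star]
    module
  rw [h]
  exact ((posSemidef_vecMulVec_self_star _).add (((one_sub_single_posSemidef _).smul
    (by norm_num)).add ((one_sub_single_posSemidef _).smul (by norm_num)))).smul (by positivity)

/-- Orthogonality of the characters `1`, `ω`, `ω̄` on the fourth roots of unity. -/
theorem sum_phase_normSq (A s t : ℂ) :
    ∑ z, ‖A + star (phase z) * s + phase z * t‖ ^ 2 = 4 * (‖A‖ ^ 2 + ‖s‖ ^ 2 + ‖t‖ ^ 2) := by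
  simp only [Fin.sum_univ_four, phase, ← Complex.normSq_eq_norm_sq, Complex.normSq_apply]
  simp
  ring

/-- Averaging over phases separates the two off-diagonal entries from the diagonal contribution,
which is dropped. The scale `d / 2` makes the constant independent of `d`. -/
theorem frame_bound (hd : 1 ≤ d) (L : Matrix (Fin d) (Fin d) ℂ →ₗ[ℂ] ℂ) :
    1 / 2 * ∑ u, ∑ v, ‖L (single u v 1)‖ ^ 2 ≤
      𝔼 y : Fin d × Fin d × Fin 4, ‖L (effect y)‖ ^ 2 := by
  have hd' : (0 : ℝ) < d := by exact_mod_cast hd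
  have key : ∀ a b : Fin d, (d : ℝ) ^ 2 * (‖L (single a b 1)‖ ^ 2 + ‖L (single b a 1)‖ ^ 2) ≤
      ∑ z, ‖L (effect (a, b, z))‖ ^ 2 := by
    intro a b
    simp only [effect_eq, map_smul, map_add, smul_eq_mul, norm_mul, mul_pow, ← mul_sum,
      sum_phase_normSq]
    simp
    nlinarith [sq_nonneg (‖L (single a a 1) + L (single b b 1)‖ * d)]
  rw [Fintype.expect_eq_sum_div_card, le_div_iff₀ (by simp; positivity)]
  simp only [Fintype.sum_prod_type, Fintype.card_prod, Fintype.card_fin]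
  refine le_trans (le_of_eq ?_) (sum_le_sum fun a _ => sum_le_sum fun b _ => key a b)
  simp only [← mul_sum, sum_add_distrib]
  rw [sum_comm (f := fun a b => ‖L (single b a 1)‖ ^ 2)]
  push_cast
  ring

theorem frame_bound_two (hd : 1 ≤ d)
    (L : Matrix (Fin d) (Fin d) ℂ →ₗ[ℂ] Matrix (Fin d) (Fin d) ℂ →ₗ[ℂ] ℂ) :
    1 / 4 * ∑ u, ∑ v, ∑ u', ∑ v', ‖L (single u v 1) (single u' v' 1)‖ ^ 2 ≤
      𝔼 y : Fin d × Fin d × Fin 4, 𝔼 y' : Fin d × Fin d × Fin 4,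
        ‖L (effect y) (effect y')‖ ^ 2 := by
  calc 1 / 4 * ∑ u, ∑ v, ∑ u', ∑ v', ‖L (single u v 1) (single u' v' 1)‖ ^ 2
      ≤ 1 / 2 * ∑ u, ∑ v, 𝔼 y' : Fin d × Fin d × Fin 4,
          ‖L (single u v 1) (effect y')‖ ^ 2 := by
        rw [show (1 / 4 : ℝ) = 1 / 2 * (1 / 2) by norm_num, mul_assoc]
        refine mul_le_mul_of_nonneg_left ?_ (by norm_num)
        rw [mul_sum]
        refine sum_le_sum fun u _ => ?_
        rw [mul_sum]
        exact sum_le_sum fun v _ => frame_bound hd (L (single u v 1))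
    _ = 𝔼 y' : Fin d × Fin d × Fin 4, 1 / 2 * ∑ u, ∑ v,
          ‖L.flip (effect y') (single u v 1)‖ ^ 2 := by
        simp only [← expect_sum_comm, mul_expect, LinearMap.flip_apply]
    _ ≤ 𝔼 y' : Fin d × Fin d × Fin 4, 𝔼 y : Fin d × Fin d × Fin 4,
          ‖L.flip (effect y') (effect y)‖ ^ 2 :=
        expect_le_expect fun y' _ => frame_bound hd (L.flip (effect y'))
    _ = _ := expect_comm _ _ _

/-! ### Outcome densities of the measured sites. -/

theorem star_pairing {ρ : Op n d} (hρ : ρ.IsHermitian) (a : Fin n → Matrix (Fin d) (Fin d) ℂ) :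
    star (pairing ρ a) = pairing ρ fun k => (a k)ᴴ := by
  rw [pairing, ← trace_conjTranspose, conjTranspose_mul, conjTranspose_tensorOp, hρ.eq,
    trace_mul_comm, pairing]

theorem reduced_posSemidef {ρ : Op n d} (hρ : ρ.PosSemidef)
    {a : Fin n → Matrix (Fin d) (Fin d) ℂ} (ha : ∀ k, (a k).PosSemidef) (i : Fin n) :
    (reduced ρ a i).PosSemidef := by
  refine PosSemidef.of_dotProduct_mulVec_nonneg ?_ fun w => ?_
  · ext u v
    rw [conjTranspose_apply, reduced, of_apply, of_apply, star_pairing hρ.isHermitian]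
    congr 1
    funext k
    by_cases hk : k = i
    · subst hk
      simp
    · simp [hk, (ha k).isHermitian.eq]
  · rw [← trace_mul_proj, ← pairing_update]
    refine pairing_nonneg hρ fun k => ?_
    by_cases hk : k = i
    · subst hk
      simpa [proj] using posSemidef_vecMulVec_self_star w
    · simpa [hk] using ha k

/-- The family `b` with the sites in `C` replaced by the effects of the outcomes `x`. -/
def measured (C : Finset (Fin n)) (x : Fin n → Fin d × Fin d × Fin 4)
    (b : Fin n → Matrix (Fin d) (Fin d) ℂ) : Fin n → Matrix (Fin d) (Fin d) ℂ :=
  fun k => if k ∈ C then effect (x k) else b k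

theorem measured_one_posSemidef (C : Finset (Fin n)) (x : Fin n → Fin d × Fin d × Fin 4)
    (k : Fin n) : (measured C x (fun _ => 1) k).PosSemidef := by
  unfold measured
  split_ifs
  exacts [effect_posSemidef _, PosSemidef.one]

theorem measured_update {C : Finset (Fin n)} {i : Fin n} (hi : i ∉ C)
    (x : Fin n → Fin d × Fin d × Fin 4) (y : Fin d × Fin d × Fin 4)
    (b : Fin n → Matrix (Fin d) (Fin d) ℂ) :
    measured C (Function.update x i y) b = measured C x b := by
  funext k
  unfold measured
  split_ifs with hk
  · rw [Function.update_of_ne (by rintro rfl; exact hi hk)]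
  · rfl

theorem measured_insert (C : Finset (Fin n)) (i : Fin n) (x : Fin n → Fin d × Fin d × Fin 4)
    (b : Fin n → Matrix (Fin d) (Fin d) ℂ) :
    measured (insert i C) x b = Function.update (measured C x b) i (effect (x i)) := by
  funext k
  by_cases hk : k = i
  · subst hk
    simp [measured]
  · simp [measured, hk]

theorem update_measured {C : Finset (Fin n)} {i : Fin n} (hi : i ∉ C)
    (x : Fin n → Fin d × Fin d × Fin 4) (b : Fin n → Matrix (Fin d) (Fin d) ℂ)
    (B : Matrix (Fin d) (Fin d) ℂ) :
    Function.update (measured C x b) i B = measured C x (Function.update b i B) := by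
  funext k
  by_cases hk : k = i
  · subst hk
    simp [measured, hi]
  · simp [measured, hk]

theorem update_measured_one {C : Finset (Fin n)} {i : Fin n} (hi : i ∉ C)
    (x : Fin n → Fin d × Fin d × Fin 4) :
    Function.update (measured C x (fun _ => 1)) i 1 = measured C x fun _ => 1 := by
  rw [update_measured hi, Function.update_eq_self_iff.2 rfl]

/-- The probability density (relative to the uniform distribution) of the outcomes `x` when the
sites in `C` are measured. -/
def prob (ρ : Op n d) (C : Finset (Fin n)) (x : Fin n → Fin d × Fin d × Fin 4) : ℝ :=
  (pairing ρ (measured C x fun _ => 1)).re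

theorem prob_nonneg {ρ : Op n d} (hρ : ρ.PosSemidef) (C : Finset (Fin n))
    (x : Fin n → Fin d × Fin d × Fin 4) : 0 ≤ prob ρ C x :=
  (Complex.le_def.1 (pairing_nonneg hρ (measured_one_posSemidef C x))).1

theorem pairing_measured {ρ : Op n d} (hρ : ρ.PosSemidef) (C : Finset (Fin n))
    (x : Fin n → Fin d × Fin d × Fin 4) :
    pairing ρ (measured C x fun _ => 1) = prob ρ C x :=
  Complex.eq_re_of_ofReal_le (r := 0)
    (by simpa using pairing_nonneg hρ (measured_one_posSemidef C x))

theorem prob_update {C : Finset (Fin n)} {i : Fin n} (hi : i ∉ C) (ρ : Op n d)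
    (x : Fin n → Fin d × Fin d × Fin 4) (y : Fin d × Fin d × Fin 4) :
    prob ρ C (Function.update x i y) = prob ρ C x := by
  rw [prob, measured_update hi, prob]

theorem prob_insert_le {ρ : Op n d} (hρ : ρ.PosSemidef) {C : Finset (Fin n)} {i : Fin n}
    (hi : i ∉ C) (x : Fin n → Fin d × Fin d × Fin 4) :
    prob ρ (insert i C) x ≤ 2 * d * prob ρ C x := by
  have h : 0 ≤ pairing ρ (Function.update (measured C x fun _ => 1) i
      ((2 * d : ℂ) • 1 - effect (x i))) := by
    refine pairing_nonneg hρ fun k => ?_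
    by_cases hk : k = i
    · subst hk
      simpa using effect_le (x k)
    · simpa [hk] using measured_one_posSemidef C x k
  rw [pairing_update, mul_sub, trace_sub, Matrix.mul_smul, trace_smul, ← pairing_update,
    ← pairing_update, update_measured_one hi, ← measured_insert, pairing_measured hρ,
    pairing_measured hρ] at h
  have := (Complex.le_def.1 h).1
  simp at this
  linarith

theorem expect_update {M : Type*} [AddCommGroup M] [Module ℚ≥0 M] {Y : Type*} [Fintype Y]
    [Nonempty Y] (i : Fin n) (f : (Fin n → Y) → M) :
    𝔼 x, f x = 𝔼 x, 𝔼 y, f (Function.update x i y) := by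
  rw [← expect_product', univ_product_univ]
  have h : 𝔼 q : (Fin n → Y) × Y, f (Function.update q.1 i q.2) =
      𝔼 q : (Fin n → Y) × Y, f q.1 := by
    -- Exchanging the fresh value with the old coordinate is an involution.
    refine expect_nbij' (fun q => (Function.update q.1 i q.2, q.1 i))
      (fun q => (Function.update q.1 i q.2, q.1 i)) ?_ ?_ ?_ ?_ ?_ <;> simp
  rw [h, ← univ_product_univ, expect_product' univ univ fun x _ => f x]
  simp

theorem expect_effect_map [NeZero d] (L : Matrix (Fin d) (Fin d) ℂ →ₗ[ℂ] ℂ) :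
    𝔼 y : Fin d × Fin d × Fin 4, L (effect y) = L 1 := by
  rw [Fintype.expect_eq_sum_div_card, ← map_sum, sum_effect, map_smul, smul_eq_mul,
    mul_div_cancel_left₀]
  simp [NeZero.ne d]

/-- Evaluation of `ρ` at a product observable, as a function of the factors at sites `i`, `j`. -/
def pairFunctional (ρ : Op n d) (a : Fin n → Matrix (Fin d) (Fin d) ℂ) {i j : Fin n}
    (hij : i ≠ j) : Matrix (Fin d) (Fin d) ℂ →ₗ[ℂ] Matrix (Fin d) (Fin d) ℂ →ₗ[ℂ] ℂ :=
  LinearMap.mk₂ ℂ (fun B B' => pairing ρ (Function.update (Function.update a i B) j B'))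
    (fun B₁ B₂ B' => by simp only [Function.update_comm hij, pairing_update, mul_add, trace_add])
    (fun c B B' => by
      simp only [Function.update_comm hij, pairing_update, Matrix.mul_smul, trace_smul])
    (fun B B₁ B₂ => by simp only [pairing_update, mul_add, trace_add])
    (fun c B B' => by simp only [pairing_update, Matrix.mul_smul, trace_smul])

/-- Evaluation of `ρ` at a product observable, as a function of the factor at site `i`. -/
def siteFunctional (ρ : Op n d) (a : Fin n → Matrix (Fin d) (Fin d) ℂ) (i : Fin n) :
    Matrix (Fin d) (Fin d) ℂ →ₗ[ℂ] ℂ where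
  toFun B := pairing ρ (Function.update a i B)
  map_add' B₁ B₂ := by simp only [pairing_update, mul_add, trace_add]
  map_smul' c B := by simp only [pairing_update, Matrix.mul_smul, trace_smul, RingHom.id_apply]

theorem expect_pairing_measured [NeZero d] (ρ : Op n d) (C : Finset (Fin n))
    (b : Fin n → Matrix (Fin d) (Fin d) ℂ) (hb : ∀ k ∈ C, b k = 1) :
    𝔼 x : Fin n → Fin d × Fin d × Fin 4, pairing ρ (measured C x b) = pairing ρ b := by
  induction C using Finset.induction_on with
  | empty => exact expect_const univ_nonempty (pairing ρ b)
  | insert i C hi ih =>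
    rw [← ih fun k hk => hb k (mem_insert_of_mem hk), expect_update i]
    refine expect_congr rfl fun x _ => ?_
    simp only [measured_insert, measured_update hi, Function.update_self]
    have h := expect_effect_map (siteFunctional ρ (measured C x b) i)
    simp only [siteFunctional, LinearMap.coe_mk, AddHom.coe_mk] at h
    rw [h, update_measured hi, ← hb i (mem_insert_self i C), Function.update_eq_self]

/-- The effects average to the identity, so an outcome on which `F` does not depend can be summed
out. -/
theorem expect_mul_prob_insert [NeZero d] {ρ : Op n d} (hρ : ρ.PosSemidef) {C : Finset (Fin n)}
    {i : Fin n} (hi : i ∉ C) (F : (Fin n → Fin d × Fin d × Fin 4) → ℝ)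
    (hF : ∀ x y, F (Function.update x i y) = F x) :
    𝔼 x, F x * prob ρ (insert i C) x = 𝔼 x, F x * prob ρ C x := by
  rw [expect_update i]
  refine expect_congr rfl fun x _ => ?_
  simp only [hF, ← mul_expect]
  congr 1
  have h := expect_effect_map (siteFunctional ρ (measured C x fun _ => 1) i)
  simp only [siteFunctional, LinearMap.coe_mk, AddHom.coe_mk, update_measured_one hi] at h
  have h2 : ∀ y, pairing ρ (Function.update (measured C x fun _ => 1) i (effect y)) =
      (prob ρ (insert i C) (Function.update x i y) : ℂ) := by
    intro y
    rw [← pairing_measured hρ, measured_insert, measured_update hi, Function.update_self]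
  simp only [h2, pairing_measured hρ] at h
  exact_mod_cast h

theorem expect_prob [NeZero d] {ρ : Op n d} (hρ : IsDensity ρ) (C : Finset (Fin n)) :
    𝔼 x, prob ρ C x = 1 := by
  have h := expect_pairing_measured ρ C (fun _ => 1) fun _ _ => rfl
  simp only [pairing_measured hρ.1] at h
  rw [pairing, tensorOp_one, mul_one, hρ.2] at h
  exact_mod_cast h

/-! ### Quadratic potential, covariances and correlations. -/

/-- The mean square of the conditional outcome densities at site `i` given the outcomes in `C`. -/
def potential (ρ : Op n d) (C : Finset (Fin n)) (i : Fin n) : ℝ :=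
  -- The upper bound of the potential is its value at measured sites, which keeps it monotone in
  -- `C`.
  if i ∈ C then 2 * d else
    𝔼 x : Fin n → Fin d × Fin d × Fin 4, prob ρ (insert i C) x ^ 2 / prob ρ C x

/-- The squared covariance of the outcomes at `i` and `j` given those in `C`, weighted by the
probability of the condition. -/
def covariance (ρ : Op n d) (C : Finset (Fin n)) (i j : Fin n)
    (x : Fin n → Fin d × Fin d × Fin 4) : ℝ :=
  (prob ρ (insert j (insert i C)) x -
    prob ρ (insert i C) x * prob ρ (insert j C) x / prob ρ C x) ^ 2 / prob ρ C x

theorem potential_nonneg {ρ : Op n d} (hρ : ρ.PosSemidef) (C : Finset (Fin n)) (i : Fin n) :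
    0 ≤ potential ρ C i := by
  unfold potential
  split_ifs
  · positivity
  · exact expect_nonneg fun x _ => div_nonneg (sq_nonneg _) (prob_nonneg hρ C x)

theorem potential_le [NeZero d] {ρ : Op n d} (hρ : IsDensity ρ) (C : Finset (Fin n)) (i : Fin n) :
    potential ρ C i ≤ 2 * d := by
  unfold potential
  split_ifs with hi
  · exact le_rfl
  · calc 𝔼 x : Fin n → Fin d × Fin d × Fin 4, prob ρ (insert i C) x ^ 2 / prob ρ C x
        ≤ 𝔼 x : Fin n → Fin d × Fin d × Fin 4, 2 * d * prob ρ (insert i C) x := by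
          refine expect_le_expect fun x _ => div_le_of_le_mul₀ (prob_nonneg hρ.1 C x)
            (mul_nonneg (by positivity) (prob_nonneg hρ.1 _ x)) ?_
          have h1 := prob_insert_le hρ.1 hi x
          have h2 := prob_nonneg hρ.1 (insert i C) x
          nlinarith
      _ = 2 * d := by rw [← mul_expect, expect_prob hρ, mul_one]

/-- Here `p, q, r, s` are the densities for `C`, `C ∪ {i}`, `C ∪ {j}` and `C ∪ {i, j}`. For positive
`p, r` the right side is `K (s - qr/p)² / r`; it is left expanded so that each term can be averaged.
-/
theorem sq_div_le_of_le_mul {p q r s K : ℝ} (hp : 0 ≤ p) (hr : 0 ≤ r) (hs : 0 ≤ s)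
    (hqp : q ≤ K * p) (hrp : r ≤ K * p) (hsr : s ≤ K * r) :
    (s - q * r / p) ^ 2 / p ≤ K * (s ^ 2 / r - 2 * (q / p * s) + (q / p) ^ 2 * r) := by
  rcases hr.eq_or_lt with rfl | hr
  · obtain rfl : s = 0 := by linarith
    simp
  rcases hp.eq_or_lt with rfl | hp
  · linarith
  have h : s ^ 2 / r - 2 * (q / p * s) + (q / p) ^ 2 * r = (s - q * r / p) ^ 2 / r := by
    field_simp
    ring
  rw [h, ← mul_div_assoc, div_le_div_iff₀ hp hr]
  nlinarith [mul_le_mul_of_nonneg_left hrp (sq_nonneg (s - q * r / p))]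

theorem covariance_nonneg {ρ : Op n d} (hρ : ρ.PosSemidef) (C : Finset (Fin n)) (i j : Fin n)
    (x : Fin n → Fin d × Fin d × Fin 4) : 0 ≤ covariance ρ C i j x :=
  div_nonneg (sq_nonneg _) (prob_nonneg hρ C x)

/-- The density at `i` given the measured outcomes is a martingale as `j` is added, so its mean
square grows by the mean squared increment. In the expanded square, `h1` and `h2` identify the cross
term and the last term with the old potential. -/
theorem expect_covariance_le [NeZero d] {ρ : Op n d} (hρ : IsDensity ρ) {C : Finset (Fin n)}
    {i j : Fin n} (hij : i ≠ j) (hi : i ∉ C) (hj : j ∉ C) :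
    𝔼 x, covariance ρ C i j x ≤ 2 * d * (potential ρ (insert j C) i - potential ρ C i) := by
  have hi' : i ∉ insert j C := by simp [hij, hi]
  have hj' : j ∉ insert i C := by simp [hij.symm, hj]
  have h1 : 𝔼 x, prob ρ (insert i C) x / prob ρ C x * prob ρ (insert j (insert i C)) x =
      potential ρ C i := by
    rw [expect_mul_prob_insert hρ.1 hj' (fun x => prob ρ (insert i C) x / prob ρ C x)
      fun x y => by simp only [prob_update hj', prob_update hj], potential, if_neg hi]
    exact expect_congr rfl fun x _ => by ring
  have h2 : 𝔼 x, (prob ρ (insert i C) x / prob ρ C x) ^ 2 * prob ρ (insert j C) x =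
      potential ρ C i := by
    rw [expect_mul_prob_insert hρ.1 hj (fun x => (prob ρ (insert i C) x / prob ρ C x) ^ 2)
      fun x y => by simp only [prob_update hj', prob_update hj], potential, if_neg hi]
    refine expect_congr rfl fun x _ => ?_
    by_cases hp : prob ρ C x = 0
    · simp [hp]
    · field_simp
  calc 𝔼 x, covariance ρ C i j x
      ≤ 𝔼 x, 2 * d * (prob ρ (insert j (insert i C)) x ^ 2 / prob ρ (insert j C) x -
          2 * (prob ρ (insert i C) x / prob ρ C x * prob ρ (insert j (insert i C)) x) +
          (prob ρ (insert i C) x / prob ρ C x) ^ 2 * prob ρ (insert j C) x) := by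
        refine expect_le_expect fun x _ => sq_div_le_of_le_mul (prob_nonneg hρ.1 _ x)
          (prob_nonneg hρ.1 _ x) (prob_nonneg hρ.1 _ x)
          (prob_insert_le hρ.1 hi x) (prob_insert_le hρ.1 hj x) ?_
        rw [insert_comm]
        exact prob_insert_le hρ.1 hi' x
    _ = 2 * d * (potential ρ (insert j C) i - potential ρ C i) := by
        rw [← mul_expect, expect_add_distrib, expect_sub_distrib, ← mul_expect, h1, h2]
        conv_rhs => rw [potential, if_neg hi', insert_comm]
        ring

theorem potential_mono [NeZero d] {ρ : Op n d} (hρ : IsDensity ρ) (C : Finset (Fin n))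
    (i j : Fin n) : potential ρ C i ≤ potential ρ (insert j C) i := by
  have hd : (0 : ℝ) < d := by exact_mod_cast NeZero.pos d
  by_cases hi : i ∈ insert j C
  · conv_rhs => rw [potential, if_pos hi]
    exact potential_le hρ C i
  · obtain ⟨hij, hi⟩ : i ≠ j ∧ i ∉ C := by simpa using hi
    by_cases hj : j ∈ C
    · rw [insert_eq_of_mem hj]
    · have h1 := expect_covariance_le hρ hij hi hj
      have h2 : 0 ≤ 𝔼 x, covariance ρ C i j x :=
        expect_nonneg fun x _ => covariance_nonneg hρ.1 C i j x
      have h3 := nonneg_of_mul_nonneg_right (h2.trans h1) (by positivity)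
      linarith

/-- Cauchy–Schwarz with weight `p`. Outcomes of weight zero are harmless, since `h` makes every `f
e` vanish there. -/
theorem sum_norm_expect_sq_le {X E : Type*} [Fintype X] [Nonempty X] [Fintype E] (f : E → X → ℂ)
    (p W : X → ℝ) (hp : ∀ x, 0 ≤ p x) (hp1 : 𝔼 x, p x = 1) (hW : ∀ x, 0 ≤ W x)
    (h : ∀ x, ∑ e, ‖f e x‖ ^ 2 ≤ p x * W x) : ∑ e, ‖𝔼 x, f e x‖ ^ 2 ≤ 𝔼 x, W x := by
  have h1 : ∀ e, ‖𝔼 x, f e x‖ ^ 2 ≤ 𝔼 x, ‖f e x‖ ^ 2 / p x := by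
    intro e
    have h2 : (∑ x, ‖f e x‖) ^ 2 ≤ (∑ x, p x) * ∑ x, ‖f e x‖ ^ 2 / p x := by
      refine sum_sq_le_sum_mul_sum_of_sq_le_mul _ (fun x _ => hp x)
        (fun x _ => div_nonneg (sq_nonneg _) (hp x)) fun x _ => ?_
      by_cases hx : p x = 0
      · have h3 := (single_le_sum (fun e _ => sq_nonneg ‖f e x‖) (mem_univ e)).trans (h x)
        rw [hx, zero_mul] at h3
        rwa [hx, zero_mul]
      · rw [mul_div_cancel₀ _ hx]
    have hN : (0 : ℝ) < Fintype.card X := by exact_mod_cast Fintype.card_pos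
    rw [Fintype.expect_eq_sum_div_card, div_eq_one_iff_eq hN.ne'] at hp1
    rw [hp1] at h2
    rw [Fintype.expect_eq_sum_div_card, Fintype.expect_eq_sum_div_card, norm_div,
      Complex.norm_natCast, div_pow, div_le_div_iff₀ (by positivity) hN]
    have h4 : ‖∑ x, f e x‖ ^ 2 ≤ (∑ x, ‖f e x‖) ^ 2 :=
      pow_le_pow_left₀ (norm_nonneg _) (norm_sum_le _ _) 2
    nlinarith
  calc ∑ e, ‖𝔼 x, f e x‖ ^ 2 ≤ ∑ e, 𝔼 x, ‖f e x‖ ^ 2 / p x := sum_le_sum fun e _ => h1 e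
    _ = 𝔼 x, (∑ e, ‖f e x‖ ^ 2) / p x := by simp only [← expect_sum_comm, sum_div]
    _ ≤ 𝔼 x, W x := expect_le_expect fun x _ => div_le_of_le_mul₀ (hp x) (hW x)
        ((h x).trans_eq (mul_comm _ _))

/-- The connected two-site correlations of `ρ` after measuring the sites in `C`, unnormalized. -/
def correlation (ρ : Op n d) (C : Finset (Fin n)) (x : Fin n → Fin d × Fin d × Fin 4)
    {i j : Fin n} (hij : i ≠ j) :
    Matrix (Fin d) (Fin d) ℂ →ₗ[ℂ] Matrix (Fin d) (Fin d) ℂ →ₗ[ℂ] ℂ :=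
  pairFunctional ρ (measured C x fun _ => 1) hij - (prob ρ C x : ℂ)⁻¹ •
    (siteFunctional ρ (measured C x fun _ => 1) i).smulRight
      (siteFunctional ρ (measured C x fun _ => 1) j)

theorem correlation_apply (ρ : Op n d) (C : Finset (Fin n)) (x : Fin n → Fin d × Fin d × Fin 4)
    {i j : Fin n} (hij : i ≠ j) (B B' : Matrix (Fin d) (Fin d) ℂ) :
    correlation ρ C x hij B B' =
      pairing ρ (Function.update (Function.update (measured C x fun _ => 1) i B) j B') -
        (prob ρ C x : ℂ)⁻¹ * (pairing ρ (Function.update (measured C x fun _ => 1) i B) *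
          pairing ρ (Function.update (measured C x fun _ => 1) j B')) := rfl

theorem norm_correlation_effect_sq {ρ : Op n d} (hρ : ρ.PosSemidef) {C : Finset (Fin n)}
    {i j : Fin n} (hij : i ≠ j) (hi : i ∉ C) (hj : j ∉ C) (x : Fin n → Fin d × Fin d × Fin 4)
    (y y' : Fin d × Fin d × Fin 4) :
    ‖correlation ρ C x hij (effect y) (effect y')‖ ^ 2 =
      prob ρ C x * covariance ρ C i j (Function.update (Function.update x i y) j y') := by
  have hj' : j ∉ insert i C := by simp [hij.symm, hj]
  have hi' : i ∉ insert j C := by simp [hij, hi]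
  set x' := Function.update (Function.update x i y) j y' with hx'
  have e1 : Function.update (measured C x fun _ => 1) i (effect y) =
      measured (insert i C) x' fun _ => 1 := by
    rw [hx', measured_update hj', measured_insert, measured_update hi, Function.update_self]
  have e2 : Function.update (measured C x fun _ => 1) j (effect y') =
      measured (insert j C) x' fun _ => 1 := by
    rw [hx', Function.update_comm hij, measured_update hi', measured_insert, measured_update hj,
      Function.update_self]
  have e3 : Function.update (Function.update (measured C x fun _ => 1) i (effect y)) j
      (effect y') = measured (insert j (insert i C)) x' fun _ => 1 := by
    rw [e1, measured_insert (insert i C) j x', show x' j = y' by rw [hx', Function.update_self]]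
  have e4 : prob ρ C x' = prob ρ C x := by rw [hx', prob_update hj, prob_update hi]
  have h : correlation ρ C x hij (effect y) (effect y') =
      ((prob ρ (insert j (insert i C)) x' -
        prob ρ (insert i C) x' * prob ρ (insert j C) x' / prob ρ C x' : ℝ) : ℂ) := by
    rw [correlation_apply, e3, e1, e2, pairing_measured hρ, pairing_measured hρ,
      pairing_measured hρ, e4]
    push_cast
    ring
  rw [h, Complex.norm_real, Real.norm_eq_abs, sq_abs, covariance, e4]
  -- If the condition has density zero, so do all its refinements, and both sides vanish.
  by_cases hp : prob ρ C x = 0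
  · have h1 := prob_insert_le hρ hi x'
    have h2 := prob_insert_le hρ hj' x'
    have h3 := prob_nonneg hρ (insert i C) x'
    have h4 := prob_nonneg hρ (insert j (insert i C)) x'
    rw [e4, hp, mul_zero] at h1
    have h5 : prob ρ (insert i C) x' = 0 := le_antisymm h1 h3
    rw [h5, mul_zero] at h2
    rw [hp, le_antisymm h2 h4]
    simp
  · field_simp

theorem sum_correlation_le [NeZero d] {ρ : Op n d} (hρ : IsDensity ρ) {C : Finset (Fin n)}
    {i j : Fin n} (hij : i ≠ j) (hi : i ∉ C) (hj : j ∉ C) :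
    ∑ e : Fin d × Fin d × Fin d × Fin d, ‖𝔼 x, correlation ρ C x hij (single e.1 e.2.1 1)
      (single e.2.2.1 e.2.2.2 1)‖ ^ 2 ≤
        8 * d * (potential ρ (insert j C) i - potential ρ C i) := by
  have hcov := fun x => covariance_nonneg hρ.1 C i j x
  refine (sum_norm_expect_sq_le (fun (e : Fin d × Fin d × Fin d × Fin d) x =>
    correlation ρ C x hij (single e.1 e.2.1 1) (single e.2.2.1 e.2.2.2 1)) (prob ρ C)
    (fun x => 4 * 𝔼 y, 𝔼 y', covariance ρ C i j (Function.update (Function.update x i y) j y'))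
    (prob_nonneg hρ.1 C) (expect_prob hρ C)
    (fun x => mul_nonneg (by norm_num) (expect_nonneg fun _ _ => expect_nonneg fun _ _ => hcov _))
    fun x => ?_).trans ?_
  · have h := frame_bound_two (NeZero.pos d) (correlation ρ C x hij)
    simp only [norm_correlation_effect_sq hρ.1 hij hi hj, ← mul_expect] at h
    simp only [Fintype.sum_prod_type]
    linarith
  · rw [← mul_expect, ← expect_update i (f := fun x => 𝔼 y', covariance ρ C i j
      (Function.update x j y')), ← expect_update j]
    have := expect_covariance_le hρ hij hi hj
    linarith

/-! ### Rounding to a separable state. -/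

theorem maximallyMixed_isDensity [NeZero d] :
    IsDensity ((d : ℂ)⁻¹ • (1 : Matrix (Fin d) (Fin d) ℂ)) :=
  ⟨PosSemidef.one.smul (by simp), by simp [trace_smul, NeZero.ne d]⟩

theorem GloballySeparable.isDensity {σ : Op n d} (hσ : GloballySeparable σ) : IsDensity σ := by
  obtain ⟨m, p, s, hp, hp1, hs, rfl⟩ := hσ
  refine ⟨posSemidef_sum _ fun z _ =>
    (tensorOp_isDensity (hs z)).1.smul (by exact_mod_cast hp z), ?_⟩
  simp only [trace_sum, trace_smul, (tensorOp_isDensity (hs _)).2, smul_eq_mul, mul_one]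
  exact_mod_cast hp1

theorem globallySeparable_of_fintype {X : Type*} [Fintype X] (p : X → ℝ)
    (s : X → Fin n → Matrix (Fin d) (Fin d) ℂ) (hp : ∀ x, 0 ≤ p x) (hp1 : ∑ x, p x = 1)
    (hs : ∀ x k, IsDensity (s x k)) :
    GloballySeparable (∑ x, (p x : ℂ) • tensorOp (s x)) := by
  refine ⟨Fintype.card X, fun z => p ((Fintype.equivFin X).symm z),
    fun z => s ((Fintype.equivFin X).symm z), fun z => hp _, ?_, fun z => hs _, ?_⟩
  · rw [← hp1]
    exact Equiv.sum_comp (Fintype.equivFin X).symm p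
  · exact (Equiv.sum_comp (Fintype.equivFin X).symm fun x => (p x : ℂ) • tensorOp (s x)).symm

/-- The state of site `k` after measuring the sites in `C` with outcomes `x`. -/
def conditionalState (ρ : Op n d) (C : Finset (Fin n)) (x : Fin n → Fin d × Fin d × Fin 4)
    (k : Fin n) : Matrix (Fin d) (Fin d) ℂ :=
  -- The default state is arbitrary: pairs meeting `C` are bounded trivially, and outcomes of
  -- density zero carry no weight.
  if k ∈ C ∨ prob ρ C x = 0 then (d : ℂ)⁻¹ • 1
  else (prob ρ C x : ℂ)⁻¹ • reduced ρ (measured C x fun _ => 1) k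

theorem trace_reduced {ρ : Op n d} (hρ : ρ.PosSemidef) {C : Finset (Fin n)} {k : Fin n}
    (hk : k ∉ C) (x : Fin n → Fin d × Fin d × Fin 4) :
    (reduced ρ (measured C x fun _ => 1) k).trace = prob ρ C x := by
  have h := pairing_update ρ (measured C x fun _ => 1) k 1
  rw [update_measured_one hk, pairing_measured hρ, mul_one] at h
  exact h.symm

theorem conditionalState_isDensity [NeZero d] {ρ : Op n d} (hρ : ρ.PosSemidef)
    (C : Finset (Fin n)) (x : Fin n → Fin d × Fin d × Fin 4) (k : Fin n) :
    IsDensity (conditionalState ρ C x k) := by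
  unfold conditionalState
  split_ifs with h
  · exact maximallyMixed_isDensity
  · obtain ⟨hk, hp⟩ := not_or.1 h
    constructor
    · refine (reduced_posSemidef hρ (measured_one_posSemidef C x) k).smul ?_
      rw [← Complex.ofReal_inv]
      exact_mod_cast inv_nonneg.2 (prob_nonneg hρ C x)
    · rw [trace_smul, trace_reduced hρ hk, smul_eq_mul, inv_mul_cancel₀]
      exact_mod_cast hp

/-- At density zero the reduced operator is positive semidefinite of trace zero, hence zero, so no
exception is needed. -/
theorem prob_mul_trace_conditionalState_mul {ρ : Op n d} (hρ : ρ.PosSemidef)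
    {C : Finset (Fin n)} {k : Fin n} (hk : k ∉ C) (x : Fin n → Fin d × Fin d × Fin 4)
    (B : Matrix (Fin d) (Fin d) ℂ) :
    (prob ρ C x : ℂ) * (conditionalState ρ C x k * B).trace =
      pairing ρ (Function.update (measured C x fun _ => 1) k B) := by
  rw [pairing_update]
  by_cases hp : prob ρ C x = 0
  · have h := trace_reduced hρ hk x
    rw [hp, Complex.ofReal_zero,
      (reduced_posSemidef hρ (measured_one_posSemidef C x) k).trace_eq_zero_iff] at h
    simp [hp, h]
  · rw [conditionalState, if_neg (not_or.2 ⟨hk, hp⟩), Matrix.smul_mul, trace_smul, smul_eq_mul,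
      mul_inv_cancel_left₀ (by exact_mod_cast hp)]

/-- The mixture, over the outcomes of measuring the sites in `C`, of the products of the
conditional single-site states. -/
def rounded (ρ : Op n d) (C : Finset (Fin n)) : Op n d :=
  ∑ x, ((prob ρ C x / Fintype.card (Fin n → Fin d × Fin d × Fin 4) : ℝ) : ℂ) •
    tensorOp (conditionalState ρ C x)

theorem rounded_globallySeparable [NeZero d] {ρ : Op n d} (hρ : IsDensity ρ)
    (C : Finset (Fin n)) : GloballySeparable (rounded ρ C) := by
  refine globallySeparable_of_fintype _ _
    (fun x => div_nonneg (prob_nonneg hρ.1 C x) (Nat.cast_nonneg _)) ?_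
    fun x k => conditionalState_isDensity hρ.1 C x k
  rw [← sum_div, ← Fintype.expect_eq_sum_div_card, expect_prob hρ]

theorem pairing_rounded (ρ : Op n d) (C : Finset (Fin n))
    (a : Fin n → Matrix (Fin d) (Fin d) ℂ) :
    pairing (rounded ρ C) a =
      𝔼 x, (prob ρ C x : ℂ) * ∏ k, (conditionalState ρ C x k * a k).trace := by
  rw [rounded, pairing_sum_smul, Fintype.expect_eq_sum_div_card, sum_div]
  refine sum_congr rfl fun x _ => ?_
  rw [pairing_tensorOp]
  push_cast
  ring

theorem pairing_rounded_single [NeZero d] {ρ : Op n d} (hρ : IsDensity ρ) {C : Finset (Fin n)}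
    {i : Fin n} (hi : i ∉ C) (B : Matrix (Fin d) (Fin d) ℂ) :
    pairing (rounded ρ C) (Function.update (fun _ => 1) i B) =
      pairing ρ (Function.update (fun _ => 1) i B) := by
  rw [pairing_rounded, ← expect_pairing_measured ρ C (Function.update (fun _ => 1) i B)
    fun k hk => Function.update_of_ne (by rintro rfl; exact hi hk) _ _]
  refine expect_congr rfl fun x _ => ?_
  rw [Fintype.prod_eq_single i fun k hk => ?_, Function.update_self,
    prob_mul_trace_conditionalState_mul hρ.1 hi, update_measured hi]
  rw [Function.update_of_ne hk, mul_one, (conditionalState_isDensity hρ.1 C x k).2]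

theorem pairing_sub_pairing_rounded [NeZero d] {ρ : Op n d} (hρ : IsDensity ρ)
    {C : Finset (Fin n)} {i j : Fin n} (hij : i ≠ j) (hi : i ∉ C) (hj : j ∉ C)
    (B B' : Matrix (Fin d) (Fin d) ℂ) :
    pairing ρ (Function.update (Function.update (fun _ => 1) i B) j B') -
      pairing (rounded ρ C) (Function.update (Function.update (fun _ => 1) i B) j B') =
        𝔼 x, correlation ρ C x hij B B' := by
  rw [pairing_rounded, ← expect_pairing_measured ρ C
    (Function.update (Function.update (fun _ => 1) i B) j B') fun k hk => by
      rw [Function.update_of_ne (by rintro rfl; exact hj hk),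
        Function.update_of_ne (by rintro rfl; exact hi hk)], ← expect_sub_distrib]
  refine expect_congr rfl fun x _ => ?_
  rw [correlation_apply, update_measured hi, update_measured hj]
  congr 1
  rw [Fintype.prod_eq_mul i j hij fun k hk => ?_, Function.update_self,
    Function.update_of_ne hij, Function.update_self, ← update_measured hi,
    ← prob_mul_trace_conditionalState_mul hρ.1 hi,
    ← prob_mul_trace_conditionalState_mul hρ.1 hj]
  · by_cases hp : (prob ρ C x : ℂ) = 0
    · simp [hp]
    · field_simp
  · rw [Function.update_of_ne hk.2, Function.update_of_ne hk.1, mul_one,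
      (conditionalState_isDensity hρ.1 C x k).2]

/-! ### Error on a pair, and choice of the measured set. -/

theorem sum_comp_le_sum_of_injective {X E : Type*} [Fintype X] [Fintype E] {φ : X → E}
    (hφ : Function.Injective φ) {g : E → ℝ} (hg : ∀ e, 0 ≤ g e) : ∑ q, g (φ q) ≤ ∑ e, g e := by
  classical
  rw [← sum_image (f := g) hφ.injOn]
  exact sum_le_univ_sum_of_nonneg hg

/-- One-site marginals off `C` are exact. For `i ≠ j` the entries are averaged correlations of
matrix units; passing from the Frobenius to the trace norm contributes `d²`. -/
theorem traceNorm_marginal_sub_rounded_sq_le [NeZero d] {ρ : Op n d} (hρ : IsDensity ρ)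
    {C : Finset (Fin n)} {i j : Fin n} (hi : i ∉ C) (hj : j ∉ C) :
    traceNorm (marginal {i, j} ρ - marginal {i, j} (rounded ρ C)) ^ 2 ≤
      8 * d ^ 3 * (potential ρ (insert j C) i - potential ρ C i) := by
  by_cases hij : i = j
  · subst hij
    have h : marginal {i, i} ρ - marginal {i, i} (rounded ρ C) = 0 := by
      ext u v
      rw [Matrix.sub_apply, marginal_diag_apply, marginal_diag_apply, pairing_rounded_single hρ hi,
        sub_self, Matrix.zero_apply]
    refine (traceNorm_sq_le _).trans ?_
    rw [h]
    have := potential_mono hρ C i i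
    simp only [Matrix.zero_apply, norm_zero, ne_eq, OfNat.ofNat_ne_zero, not_false_eq_true,
      zero_pow, sum_const_zero, mul_zero]
    exact mul_nonneg (by positivity) (by linarith)
  · have hinj : Function.Injective fun u : Config d ({i, j} : Finset (Fin n)) =>
        (u ⟨i, by simp⟩, u ⟨j, by simp⟩) := by
      intro u v huv
      funext ⟨k, hk⟩
      rcases mem_insert.1 hk with rfl | hk'
      · exact congrArg Prod.fst huv
      · obtain rfl := mem_singleton.1 hk'
        exact congrArg Prod.snd huv
    have hcard : (Fintype.card (Config d ({i, j} : Finset (Fin n))) : ℝ) ≤ d ^ 2 := by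
      have h := Fintype.card_le_of_injective _ hinj
      rw [Fintype.card_prod, Fintype.card_fin, ← pow_two] at h
      exact_mod_cast h
    have hsum : ∑ u, ∑ v, ‖(marginal {i, j} ρ - marginal {i, j} (rounded ρ C)) u v‖ ^ 2 ≤
        ∑ e : Fin d × Fin d × Fin d × Fin d, ‖𝔼 x, correlation ρ C x hij
          (single e.1 e.2.1 1) (single e.2.2.1 e.2.2.2 1)‖ ^ 2 := by
      have hinj₂ : Function.Injective fun q : Config d ({i, j} : Finset (Fin n)) ×
          Config d ({i, j} : Finset (Fin n)) =>
          (q.2 ⟨i, by simp⟩, q.1 ⟨i, by simp⟩, q.2 ⟨j, by simp⟩, q.1 ⟨j, by simp⟩) := by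
        rintro ⟨u, v⟩ ⟨u', v'⟩ h
        simp only [Prod.mk.injEq] at h
        rw [Prod.mk.injEq]
        exact ⟨hinj (Prod.ext h.2.1 h.2.2.2), hinj (Prod.ext h.1 h.2.2.1)⟩
      refine le_trans (Eq.le ?_) (sum_comp_le_sum_of_injective hinj₂ fun e => sq_nonneg _)
      rw [← Fintype.sum_prod_type']
      refine sum_congr rfl fun q _ => ?_
      rw [Matrix.sub_apply, marginal_pair_apply hij, marginal_pair_apply hij,
        pairing_sub_pairing_rounded hρ hij hi hj]
    calc traceNorm (marginal {i, j} ρ - marginal {i, j} (rounded ρ C)) ^ 2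
        ≤ d ^ 2 * (8 * d * (potential ρ (insert j C) i - potential ρ C i)) :=
          (traceNorm_sq_le _).trans (mul_le_mul hcard
            (hsum.trans (sum_correlation_le hρ hij hi hj)) (by positivity) (by positivity))
      _ = 8 * d ^ 3 * (potential ρ (insert j C) i - potential ρ C i) := by ring

/-- For a minimizer of the penalized functional, comparison with `∅` bounds the weight of `C`, and
comparison with each `insert j C` bounds the increments due to `j`. -/
theorem exists_conditioning_set [NeZero d] {ρ : Op n d} (hρ : IsDensity ρ) {π : Fin n → ℝ}
    (hπ : ∀ i, 0 ≤ π i) (hπ1 : ∑ i, π i = 1) {μ : ℝ} (hμ : 0 < μ) :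
    ∃ C : Finset (Fin n), ∑ i ∈ C, π i ≤ 1 / μ ∧
      ∑ i, ∑ j, π i * π j * (potential ρ (insert j C) i - potential ρ C i) ≤
        2 * d * μ * ∑ j, π j ^ 2 := by
  have hd : (0 : ℝ) < d := by exact_mod_cast NeZero.pos d
  obtain ⟨C, -, hC⟩ := exists_min_image (univ : Finset (Finset (Fin n)))
    (fun C => 2 * d * μ * ∑ i ∈ C, π i - ∑ i, π i * potential ρ C i) univ_nonempty
  refine ⟨C, ?_, ?_⟩
  · have h1 := hC ∅ (mem_univ _)
    have h2 : ∑ i, π i * potential ρ C i ≤ 2 * d := by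
      calc ∑ i, π i * potential ρ C i ≤ ∑ i, π i * (2 * d) :=
            sum_le_sum fun i _ => mul_le_mul_of_nonneg_left (potential_le hρ C i) (hπ i)
        _ = 2 * d := by rw [← sum_mul, hπ1, one_mul]
    have h3 : 0 ≤ ∑ i, π i * potential ρ ∅ i :=
      sum_nonneg fun i _ => mul_nonneg (hπ i) (potential_nonneg hρ.1 _ _)
    simp only [sum_empty, mul_zero] at h1
    have h4 : 2 * d * (μ * ∑ i ∈ C, π i) ≤ 2 * d * 1 := by linarith
    rw [le_div_iff₀ hμ, mul_comm]
    exact le_of_mul_le_mul_left h4 (by positivity)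
  · rw [sum_comm, mul_sum]
    refine sum_le_sum fun j _ => ?_
    have h1 := hC (insert j C) (mem_univ _)
    have h2 : ∑ i ∈ insert j C, π i ≤ ∑ i ∈ C, π i + π j := by
      by_cases hj : j ∈ C
      · rw [insert_eq_of_mem hj]
        linarith [hπ j]
      · rw [sum_insert hj, add_comm]
    have h3 : ∑ i, π i * π j * (potential ρ (insert j C) i - potential ρ C i) =
        π j * (∑ i, π i * potential ρ (insert j C) i - ∑ i, π i * potential ρ C i) := by
      rw [← sum_sub_distrib, mul_sum]
      exact sum_congr rfl fun i _ => by ring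
    have h4 := mul_le_mul_of_nonneg_left h2 (by positivity : 0 ≤ 2 * d * μ)
    rw [h3, pow_two, mul_left_comm]
    exact mul_le_mul_of_nonneg_left (by linarith) (hπ j)

/-! ### Averaging over `G` and choosing the parameter. -/

theorem sum_stationary (G : Matrix (Fin n) (Fin n) ℝ) :
    ∑ i, stationary G i = ∑ i, ∑ j, G i j :=
  sum_comm

/-- Cauchy–Schwarz based on `G_ij² = A_ij A_ji π_i π_j`, by symmetry; where `π` vanishes, so does
`G`. -/
theorem sq_sum_mul_le_trace {G : Matrix (Fin n) (Fin n) ℝ} (hGsymm : G.IsSymm)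
    (hG : ∀ i j, 0 ≤ G i j) (y : Fin n → Fin n → ℝ) :
    (∑ i, ∑ j, G i j * y i j) ^ 2 ≤ (walkMatrix G * walkMatrix G).trace *
      ∑ i, ∑ j, stationary G i * stationary G j * y i j ^ 2 := by
  have hπ : ∀ i, 0 ≤ stationary G i := fun i => sum_nonneg fun k _ => hG k i
  have hsymm : ∀ i j, G j i = G i j := fun i j => hGsymm.apply i j
  simp only [trace, diag_apply, mul_apply, walkMatrix, of_apply]
  simp only [← Fintype.sum_prod_type']
  refine sum_sq_le_sum_mul_sum_of_sq_le_mul _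
    (fun q _ => mul_nonneg (div_nonneg (hG _ _) (hπ _)) (div_nonneg (hG _ _) (hπ _)))
    (fun q _ => mul_nonneg (mul_nonneg (hπ _) (hπ _)) (sq_nonneg _)) fun q _ => ?_
  have h0 : ∀ i j, stationary G j = 0 → G i j = 0 := fun i j h =>
    (sum_eq_zero_iff_of_nonneg fun k _ => hG k j).1 h i (mem_univ i)
  rw [hsymm q.1 q.2]
  by_cases h1 : stationary G q.1 = 0
  · rw [← hsymm, h0 _ _ h1]
    simp
  by_cases h2 : stationary G q.2 = 0
  · rw [h0 _ _ h2]
    simp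
  refine le_of_eq ?_
  field_simp

theorem sum_traceNorm_rounded_le [NeZero d] {ρ : Op n d} (hρ : IsDensity ρ)
    {G : Matrix (Fin n) (Fin n) ℝ} (hGsymm : G.IsSymm) (hG : ∀ i j, 0 ≤ G i j)
    (hG1 : ∑ i, ∑ j, G i j = 1) {μ : ℝ} (hμ : 0 < μ) :
    ∃ σ : Op n d, GloballySeparable σ ∧
      ∑ i, ∑ j, G i j * traceNorm (marginal {i, j} ρ - marginal {i, j} σ) ≤
        4 * Real.sqrt (d ^ 4 * (walkMatrix G * walkMatrix G).trace *
          (∑ j, stationary G j ^ 2) * μ) + 4 / μ := by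
  have hπ : ∀ i, 0 ≤ stationary G i := fun i => sum_nonneg fun k _ => hG k i
  have hπ1 : ∑ i, stationary G i = 1 := (sum_stationary G).trans hG1
  have hrow : ∀ i, ∑ j, G i j = stationary G i := fun i =>
    sum_congr rfl fun j _ => hGsymm.apply j i
  obtain ⟨C, hC1, hC2⟩ := exists_conditioning_set hρ hπ hπ1 hμ
  have hsep := rounded_globallySeparable hρ C
  refine ⟨rounded ρ C, hsep, ?_⟩
  set inc : Fin n → Fin n → ℝ := fun i j => potential ρ (insert j C) i - potential ρ C i with hinc
  have hinc0 : ∀ i j, 0 ≤ inc i j := fun i j => sub_nonneg.2 (potential_mono hρ C i j)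
  have hpt : ∀ i j, traceNorm (marginal {i, j} ρ - marginal {i, j} (rounded ρ C)) ≤
      Real.sqrt (8 * d ^ 3 * inc i j) + 2 * (if i ∈ C then 1 else 0) +
        2 * (if j ∈ C then 1 else 0) := by
    intro i j
    have h1 := traceNorm_sub_le_two (marginal_isDensity {i, j} hρ)
      (marginal_isDensity {i, j} hsep.isDensity)
    have h2 := Real.sqrt_nonneg (8 * d ^ 3 * inc i j)
    by_cases hi : i ∈ C
    · rw [if_pos hi]
      split_ifs <;> linarith
    by_cases hj : j ∈ C
    · rw [if_pos hj, if_neg hi]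
      linarith
    · have h3 := Real.le_sqrt_of_sq_le (traceNorm_marginal_sub_rounded_sq_le hρ hi hj)
      simpa [hi, hj] using h3
  have hhit1 : ∑ i, ∑ j, G i j * (2 * if i ∈ C then 1 else 0) ≤ 2 / μ := by
    simp only [← sum_mul, hrow]
    simp only [mul_ite, mul_one, mul_zero, sum_ite_mem, univ_inter, ← sum_mul]
    linarith [show 2 / μ = 2 * (1 / μ) by ring]
  have hhit2 : ∑ i, ∑ j, G i j * (2 * if j ∈ C then 1 else 0) ≤ 2 / μ := by
    rw [sum_comm]
    refine le_trans (le_of_eq (sum_congr rfl fun i _ => sum_congr rfl fun j _ => ?_)) hhit1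
    rw [hGsymm.apply]
  have hmain : ∑ i, ∑ j, G i j * Real.sqrt (8 * d ^ 3 * inc i j) ≤
      4 * Real.sqrt (d ^ 4 * (walkMatrix G * walkMatrix G).trace *
        (∑ j, stationary G j ^ 2) * μ) := by
    have h1 := sq_sum_mul_le_trace hGsymm hG fun i j => Real.sqrt (8 * d ^ 3 * inc i j)
    have hT : 0 ≤ (walkMatrix G * walkMatrix G).trace := by
      simp only [trace, diag_apply, mul_apply, walkMatrix, of_apply]
      exact sum_nonneg fun i _ => sum_nonneg fun j _ =>
        mul_nonneg (div_nonneg (hG _ _) (hπ _)) (div_nonneg (hG _ _) (hπ _))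
    have h2 : ∑ i, ∑ j, stationary G i * stationary G j * Real.sqrt (8 * d ^ 3 * inc i j) ^ 2 ≤
        8 * d ^ 3 * (2 * d * μ * ∑ j, stationary G j ^ 2) := by
      refine le_trans (le_of_eq ?_) (mul_le_mul_of_nonneg_left hC2 (by positivity))
      rw [mul_sum]
      refine sum_congr rfl fun i _ => ?_
      rw [mul_sum]
      refine sum_congr rfl fun j _ => ?_
      rw [Real.sq_sqrt (mul_nonneg (by positivity) (hinc0 i j))]
      ring
    have h3 := Real.le_sqrt_of_sq_le (h1.trans (mul_le_mul_of_nonneg_left h2 hT))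
    refine h3.trans_eq ?_
    rw [show (4 : ℝ) = Real.sqrt (4 ^ 2) by rw [Real.sqrt_sq (by norm_num)],
      ← Real.sqrt_mul (by norm_num)]
    congr 1
    ring
  calc ∑ i, ∑ j, G i j * traceNorm (marginal {i, j} ρ - marginal {i, j} (rounded ρ C))
      ≤ ∑ i, ∑ j, (G i j * Real.sqrt (8 * d ^ 3 * inc i j) +
          G i j * (2 * if i ∈ C then 1 else 0) + G i j * (2 * if j ∈ C then 1 else 0)) := by
        refine sum_le_sum fun i _ => sum_le_sum fun j _ => ?_
        rw [← mul_add, ← mul_add]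
        exact mul_le_mul_of_nonneg_left (hpt i j) (hG i j)
    _ ≤ _ := by
        simp only [sum_add_distrib]
        have : 4 / μ = 2 / μ + 2 / μ := by ring
        linarith

theorem exists_separable_approximation (hd : 1 ≤ d) {ρ : Op n d} (hρ : IsDensity ρ)
    {G : Matrix (Fin n) (Fin n) ℝ} (hGsymm : G.IsSymm) (hG : ∀ i j, 0 ≤ G i j)
    (hG1 : ∑ i, ∑ j, G i j = 1) :
    ∃ σ : Op n d, GloballySeparable σ ∧
      ∑ i, ∑ j, G i j * traceNorm (marginal {i, j} ρ - marginal {i, j} σ) ≤ errorBound d G := by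
  have : NeZero d := ⟨by omega⟩
  have hs : 0 ≤ ∑ j, stationary G j ^ 2 := sum_nonneg fun j _ => sq_nonneg _
  have hmix : GloballySeparable (∑ _x : Unit, ((1 : ℝ) : ℂ) •
      tensorOp (fun _ : Fin n => (d : ℂ)⁻¹ • (1 : Matrix (Fin d) (Fin d) ℂ))) :=
    globallySeparable_of_fintype (fun _ => 1) _ (fun _ => zero_le_one) (by simp)
      fun _ _ => maximallyMixed_isDensity
  -- For `d = 1` the logarithm kills the main error term, but then all states coincide.
  rcases hd.eq_or_lt with rfl | hd2
  · refine ⟨_, hmix, ?_⟩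
    have h : ∀ τ υ : Op n 1, IsDensity τ → IsDensity υ → ∀ S,
        traceNorm (marginal S τ - marginal S υ) = 0 := by
      intro τ υ hτ hυ S
      have h1 : marginal S τ - marginal S υ = 0 := by
        have h2 : ∀ A : Matrix (Config 1 S) (Config 1 S) ℂ, IsDensity A → ∀ u v, A u v = 1 := by
          intro A hA u v
          have h3 := hA.2
          rw [trace, Fintype.sum_subsingleton _ u, diag_apply] at h3
          rwa [Subsingleton.elim v u]
        ext u v
        rw [Matrix.sub_apply, h2 _ (marginal_isDensity S hτ), h2 _ (marginal_isDensity S hυ),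
          sub_self, Matrix.zero_apply]
      have h4 := traceNorm_sq_le (marginal S τ - marginal S υ)
      rw [h1] at h4 ⊢
      simp only [Matrix.zero_apply, norm_zero, ne_eq, OfNat.ofNat_ne_zero, not_false_eq_true,
        zero_pow, sum_const_zero, mul_zero] at h4
      exact pow_eq_zero_iff two_ne_zero |>.1 (le_antisymm h4 (sq_nonneg _))
    simp only [h ρ _ hρ hmix.isDensity, mul_zero, sum_const_zero]
    simpa [errorBound] using hs
  · set T := (walkMatrix G * walkMatrix G).trace with hT
    set s := ∑ j, stationary G j ^ 2 with hs'
    have hπ1 : ∑ i, stationary G i = 1 := (sum_stationary G).trans hG1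
    have hT1 : 1 ≤ T := by
      have h := sq_sum_mul_le_trace hGsymm hG fun _ _ => 1
      simp only [mul_one, hG1, one_pow, ← mul_sum, hπ1] at h
      exact h
    have hs0 : 0 < s := by
      refine hs.lt_of_ne fun h => ?_
      have h1 := (sum_eq_zero_iff_of_nonneg fun j _ => sq_nonneg (stationary G j)).1 h.symm
      have h2 : ∑ i, stationary G i = 0 := sum_eq_zero fun i hi => by simpa using h1 i hi
      linarith
    have hd0 : (0 : ℝ) < d := by exact_mod_cast NeZero.pos d
    set t := (d : ℝ) ^ 4 * T * s with ht
    have ht0 : 0 < t := by positivity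
    set u := t ^ (1 / 8 : ℝ) with hu
    have hu0 : 0 < u := Real.rpow_pos_of_pos ht0 _
    have hu8 : u ^ 8 = t := by
      rw [hu, ← Real.rpow_natCast, ← Real.rpow_mul ht0.le]
      norm_num
    -- Since `14 · 4/7 = 8`, this absorbs the logarithm into the constant of the bound `8 * u`.
    have hlog : (4 / 7 : ℝ) ^ 8 ≤ Real.log d := by
      have h1 : Real.log 2 ≤ Real.log d := Real.log_le_log (by norm_num) (by exact_mod_cast hd2)
      have h2 := Real.log_two_gt_d9
      norm_num at h2 ⊢
      linarith
    have hlog8 : 4 / 7 ≤ Real.log d ^ (1 / 8 : ℝ) := by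
      have h1 := Real.rpow_le_rpow (z := 1 / 8) (by positivity) hlog (by norm_num)
      rwa [← Real.rpow_natCast, ← Real.rpow_mul (by norm_num), show ((8 : ℕ) : ℝ) * (1 / 8) = 1 by
        norm_num, Real.rpow_one] at h1
    have herr : 8 * u ≤ errorBound d G := by
      have h1 : (d : ℝ) ^ 4 * Real.log d * T * s = t * Real.log d := by rw [ht]; ring
      rw [errorBound, ← hT, ← hs', h1, Real.mul_rpow ht0.le ((by positivity : (0 : ℝ) ≤ (4 / 7) ^ 8).trans hlog), ← hu]
      nlinarith [mul_le_mul_of_nonneg_left hlog8 hu0.le]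
    -- If `u ≥ 1`, the trivial bound `2` suffices. Otherwise `μ = 1/u` gives `√(t/u) = u^(7/2) ≤ u`.
    rcases le_or_gt 1 u with hu1 | hu1
    · refine ⟨_, hmix, ?_⟩
      calc _ ≤ ∑ i, ∑ j, G i j * 2 := sum_le_sum fun i _ => sum_le_sum fun j _ =>
            mul_le_mul_of_nonneg_left (traceNorm_sub_le_two (marginal_isDensity _ hρ)
              (marginal_isDensity _ hmix.isDensity)) (hG i j)
        _ = 2 := by simp only [← sum_mul, hG1, one_mul]
        _ ≤ errorBound d G := by linarith
    · obtain ⟨σ, hσ, h⟩ := sum_traceNorm_rounded_le hρ hGsymm hG hG1 (μ := 1 / u) (by positivity)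
      refine ⟨σ, hσ, h.trans ?_⟩
      have h1 : Real.sqrt (t * (1 / u)) ≤ u := by
        refine Real.sqrt_le_iff.2 ⟨hu0.le, ?_⟩
        rw [← hu8, mul_one_div, div_le_iff₀ hu0]
        calc u ^ 8 = u ^ 3 * u ^ 5 := by ring
          _ ≤ u ^ 3 * 1 := mul_le_mul_of_nonneg_left (pow_le_one₀ hu0.le hu1.le) (by positivity)
          _ = u ^ 2 * u := by ring
      have h2 : 4 / (1 / u) = 4 * u := by field_simp
      rw [h2]
      linarith

/-! ### Energies, and passage to product vectors. -/

theorem exists_le_of_weighted_average {X : Type*} [Fintype X] {w f : X → ℝ} {e : ℝ}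
    (hw : ∀ x, 0 ≤ w x) (hw1 : ∑ x, w x = 1) (h : ∑ x, w x * f x ≤ e) : ∃ x, f x ≤ e := by
  by_contra! hf
  have h1 : ∀ x, 0 ≤ w x * (f x - e) := fun x => mul_nonneg (hw x) (sub_nonneg.2 (hf x).le)
  have h2 : ∑ x, w x * (f x - e) ≤ 0 := by
    simp only [mul_sub, sum_sub_distrib, ← sum_mul, hw1]
    linarith
  have h3 := (sum_eq_zero_iff_of_nonneg fun x _ => h1 x).1
    (le_antisymm h2 (sum_nonneg fun x _ => h1 x))
  have h4 : ∀ x, w x = 0 := fun x =>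
    (mul_eq_zero.1 (h3 x (mem_univ x))).resolve_right (sub_pos.2 (hf x)).ne'
  simp [h4] at hw1

theorem proj_isDensity {ι : Type*} [Fintype ι] {ψ : ι → ℂ} (hψ : star ψ ⬝ᵥ ψ = 1) :
    IsDensity (proj ψ) :=
  ⟨posSemidef_vecMulVec_self_star ψ, by rw [proj, trace_vecMulVec, dotProduct_comm, hψ]⟩

theorem dotProduct_star_self_eq_one {ι : Type*} [Fintype ι] {v : EuclideanSpace ℂ ι}
    (hv : ‖v‖ = 1) : star v.ofLp ⬝ᵥ v.ofLp = 1 := by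
  have h := EuclideanSpace.inner_eq_star_dotProduct v v
  rw [inner_self_eq_norm_sq_to_K, hv, dotProduct_comm] at h
  simpa using h.symm

theorem le_re_trace_mul {ι : Type*} [Fintype ι] [DecidableEq ι] {H τ : Matrix ι ι ℂ}
    (hH : H.IsHermitian) (hτ : IsDensity τ) {e : ℝ} (he : ∀ i, e ≤ hH.eigenvalues i) :
    e ≤ (H * τ).trace.re := by
  have h1 : (H * τ).trace.re = ∑ i, hH.eigenvalues i *
      (proj (hH.eigenvectorBasis i).ofLp * τ).trace.re := by
    conv_lhs => rw [eq_sum_eigenvalues_smul_proj hH]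
    rw [sum_mul, trace_sum, Complex.re_sum]
    refine sum_congr rfl fun i _ => ?_
    rw [Matrix.smul_mul, trace_smul, smul_eq_mul, Complex.re_ofReal_mul]
  have h2 : ∑ i, (proj (hH.eigenvectorBasis i).ofLp * τ).trace.re = 1 := by
    rw [← Complex.re_sum, ← trace_sum, ← sum_mul, sum_proj_eigenvectorBasis, one_mul, hτ.2,
      Complex.one_re]
  rw [h1, ← mul_one e, ← h2, mul_sum]
  exact sum_le_sum fun i _ => mul_le_mul_of_nonneg_right (he i)
    (Complex.le_def.1 (trace_mul_nonneg (posSemidef_vecMulVec_self_star _) hτ.1)).1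

theorem exists_ground_state {ι : Type*} [Fintype ι] [DecidableEq ι] [Nonempty ι]
    {H : Matrix ι ι ℂ} (hH : H.IsHermitian) :
    ∃ ρ : Matrix ι ι ℂ, IsDensity ρ ∧ (H * ρ).trace.re ≤ groundEnergy H := by
  obtain ⟨i, hi⟩ := Finite.exists_min hH.eigenvalues
  have hv := dotProduct_star_self_eq_one (hH.eigenvectorBasis.orthonormal.1 i)
  refine ⟨proj (hH.eigenvectorBasis i).ofLp, proj_isDensity hv, ?_⟩
  have h := hH.eigenvalues_eq i
  rw [trace_mul_proj]
  refine le_csInf ⟨_, _, hv, rfl⟩ ?_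
  rintro e ⟨ψ, hψ, rfl⟩
  rw [← trace_mul_proj H ψ]
  refine h.symm.le.trans (le_re_trace_mul hH (proj_isDensity hψ) hi)

theorem re_trace_mul_sum_smul {ι X : Type*} [Fintype ι] [Fintype X] (H : Matrix ι ι ℂ) (c : X → ℝ)
    (A : X → Matrix ι ι ℂ) :
    (H * ∑ x, (c x : ℂ) • A x).trace.re = ∑ x, c x * (H * A x).trace.re := by
  simp only [Matrix.mul_sum, Matrix.mul_smul, trace_sum, trace_smul, smul_eq_mul, Complex.re_sum,
    Complex.re_ofReal_mul]

theorem tensorOp_proj (φ : Fin n → EuclideanSpace ℂ (Fin d)) :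
    tensorOp (fun k => proj (φ k).ofLp) = proj (tensorVec φ) := by
  ext x y
  simp [tensorOp, proj, tensorVec, vecMulVec_apply, prod_mul_distrib]

theorem tensorOp_sum_smul {κ : Type*} [Fintype κ] (c : Fin n → κ → ℂ)
    (B : Fin n → κ → Matrix (Fin d) (Fin d) ℂ) :
    tensorOp (fun k => ∑ a, c k a • B k a) =
      ∑ f : Fin n → κ, (∏ k, c k (f k)) • tensorOp fun k => B k (f k) := by
  ext x y
  simp only [tensorOp, of_apply, Matrix.sum_apply, Matrix.smul_apply, smul_eq_mul,
    prod_univ_sum, Fintype.piFinset_univ, prod_mul_distrib]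

/-- Some member of a mixture has energy at most the average. This is used once for the mixture of
product states, and once for the spectral decompositions of the factors, with products of
eigenvalues as weights. -/
theorem exists_product_vector_le {H σ : Op n d} (hσ : GloballySeparable σ) :
    ∃ φ : Fin n → EuclideanSpace ℂ (Fin d), (∀ k, ‖φ k‖ = 1) ∧
      (H * proj (tensorVec φ)).trace.re ≤ (H * σ).trace.re := by
  obtain ⟨m, p, s, hp, hp1, hs, rfl⟩ := hσ
  obtain ⟨z, hz⟩ := exists_le_of_weighted_average
    (f := fun z => (H * tensorOp (s z)).trace.re) hp hp1
    (re_trace_mul_sum_smul H p fun z => tensorOp (s z)).ge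
  have hH := fun k => (hs z k).1.isHermitian
  have hdec : tensorOp (s z) = ∑ f : Fin n → Fin d,
      ((∏ k, (hH k).eigenvalues (f k) : ℝ) : ℂ) •
        proj (tensorVec fun k => (hH k).eigenvectorBasis (f k)) := by
    have h : s z = fun k => ∑ a, ((hH k).eigenvalues a : ℂ) •
        proj ((hH k).eigenvectorBasis a).ofLp :=
      funext fun k => eq_sum_eigenvalues_smul_proj (hH k)
    conv_lhs => rw [h]
    rw [tensorOp_sum_smul]
    refine sum_congr rfl fun f _ => ?_
    rw [← tensorOp_proj]
    push_cast
    rfl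
  obtain ⟨f, hf⟩ := exists_le_of_weighted_average 
    (w := fun f : Fin n → Fin d => ∏ k, (hH k).eigenvalues (f k))
    (f := fun f => (H * proj (tensorVec fun k => (hH k).eigenvectorBasis (f k))).trace.re)
    (e := (H * tensorOp (s z)).trace.re)
    (fun f => prod_nonneg fun k _ => (hs z k).1.eigenvalues_nonneg _) (by
      have h : ∀ k, ∑ a, (hH k).eigenvalues a = 1 := fun k => by
        have h1 := (hH k).trace_eq_sum_eigenvalues
        rw [(hs z k).2] at h1
        exact Complex.ofReal_injective (by simpa using h1.symm)
      rw [← Fintype.piFinset_univ, ← prod_univ_sum]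
      simp [h]) (by rw [hdec, re_trace_mul_sum_smul])
  exact ⟨fun k => (hH k).eigenvectorBasis (f k),
    fun k => (hH k).eigenvectorBasis.orthonormal.1 _, hf.trans hz⟩

/-- Padding `v` with the basis label `0` off `S` gives a unit vector with marginal `proj v`, so the
norm of the extension controls `h`. -/
theorem re_trace_mul_proj_abs_le_of_extend [NeZero d] (S : Finset (Fin n))
    (h : Matrix (Config d S) (Config d S) ℂ) (v : EuclideanSpace ℂ (Config d S)) (hv : ‖v‖ = 1) :
    |(h * proj v.ofLp).trace.re| ≤ opNorm (extend S h) := by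
  set w : EuclideanSpace ℂ (Fin n → Fin d) := WithLp.toLp 2 fun x =>
    if (fun k : {k : Fin n // k ∉ S} => x k.1) = 0 then v fun k => x k.1 else 0 with hw
  have hglue : ∀ u z, w (glue S u z) = if z = 0 then v u else 0 := by
    intro u z
    have h1 : (fun k : {k : Fin n // k ∉ S} => glue S u z k.1) = z := by
      funext ⟨k, hk⟩
      simp [glue, hk]
    have h2 : (fun k : {k : Fin n // k ∈ S} => glue S u z k.1) = u := by
      funext ⟨k, hk⟩
      simp [glue, hk]
    simp only [hw, h1, h2]
  have hnorm : ‖w‖ = 1 := by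
    rw [← hv, EuclideanSpace.norm_eq, EuclideanSpace.norm_eq, sum_eq_sum_glue S]
    simp [hglue, apply_ite norm, ite_pow]
  have hmarg : marginal S (proj w.ofLp) = proj v.ofLp := by
    ext a b
    simp [marginal, proj, vecMulVec_apply, hglue]
  have h1 := re_trace_mul_proj_abs_le (extend S h) w hnorm
  rwa [trace_mul_comm, trace_mul_extend, hmarg, trace_mul_comm] at h1

theorem re_trace_actsOnlyOn_mul_sub_le [NeZero d] {S : Finset (Fin n)} {M : Op n d}
    (hM : ActsOnlyOn S M) (hM1 : opNorm M ≤ 1) {ρ σ : Op n d} (hρ : IsDensity ρ)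
    (hσ : IsDensity σ) :
    (M * σ).trace.re - (M * ρ).trace.re ≤ traceNorm (marginal S ρ - marginal S σ) := by
  obtain ⟨h, rfl⟩ := hM
  have h1 := re_trace_mul_abs_le
    ((marginal_isDensity S hρ).1.isHermitian.sub (marginal_isDensity S hσ).1.isHermitian)
    fun v hv => (re_trace_mul_proj_abs_le_of_extend S h v hv).trans hM1
  rw [mul_sub, trace_sub, Complex.sub_re, one_mul, trace_mul_comm h, trace_mul_comm h,
    ← trace_mul_extend, ← trace_mul_extend, trace_mul_comm ρ, trace_mul_comm σ] at h1
  linarith [neg_le_of_abs_le h1]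

theorem exists_product_vector_approximation (hd : 1 ≤ d) {G : Matrix (Fin n) (Fin n) ℝ}
    (hGsymm : G.IsSymm) (hG : ∀ i j, 0 ≤ G i j) (hG1 : ∑ i, ∑ j, G i j = 1)
    (Hterm : Fin n → Fin n → Op n d) (hherm : ∀ i j, (Hterm i j).IsHermitian)
    (hnorm : ∀ i j, opNorm (Hterm i j) ≤ 1) (hloc : ∀ i j, ActsOnlyOn {i, j} (Hterm i j)) :
    ∃ φ : Fin n → EuclideanSpace ℂ (Fin d), (∀ k, ‖φ k‖ = 1) ∧
      ((∑ i, ∑ j, (G i j : ℂ) • Hterm i j) * proj (tensorVec φ)).trace.re ≤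
        groundEnergy (∑ i, ∑ j, (G i j : ℂ) • Hterm i j) + errorBound d G := by
  have : NeZero d := ⟨by omega⟩
  set H : Op n d := ∑ i, ∑ j, (G i j : ℂ) • Hterm i j with hHdef
  have hH : H.IsHermitian := by
    rw [IsHermitian, hHdef]
    simp only [conjTranspose_sum, conjTranspose_smul, (hherm _ _).eq, Complex.star_def,
      Complex.conj_ofReal]
  obtain ⟨ρ, hρ, hρe⟩ := exists_ground_state hH
  obtain ⟨σ, hσ, hσe⟩ := exists_separable_approximation hd hρ hGsymm hG hG1
  obtain ⟨φ, hφ, hφe⟩ := exists_product_vector_le (H := H) hσ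
  refine ⟨φ, hφ, hφe.trans ?_⟩
  have hexp : ∀ τ : Op n d, (H * τ).trace.re = ∑ i, ∑ j, G i j * (Hterm i j * τ).trace.re := by
    intro τ
    simp only [hHdef, sum_mul, trace_sum, Complex.re_sum, Matrix.smul_mul, trace_smul, smul_eq_mul,
      Complex.re_ofReal_mul]
  have hdiff : (H * σ).trace.re - (H * ρ).trace.re ≤ errorBound d G := by
    refine le_trans ?_ hσe
    simp only [hexp, ← sum_sub_distrib, ← mul_sub]
    exact sum_le_sum fun i _ => sum_le_sum fun j _ => mul_le_mul_of_nonneg_left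
      (re_trace_actsOnlyOn_mul_sub_le (hloc i j) (hnorm i j) hρ hσ.isDensity) (hG i j)
  linarith

end ProductApprox

end

theorem mainTheorem3 (n d : ℕ) (hd : 1 ≤ d) (G : Matrix (Fin n) (Fin n) ℝ)
    (hGsymm : G.IsSymm) (hGnonneg : ∀ i j, 0 ≤ G i j) (hGsum : ∑ i, ∑ j, G i j = 1) :
    (∀ ρ : ProductApprox.Op n d, ProductApprox.IsDensity ρ →
      ∃ σ : ProductApprox.Op n d, ProductApprox.GloballySeparable σ ∧
        ∑ i, ∑ j, G i j * ProductApprox.traceNorm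
          (ProductApprox.marginal {i, j} ρ - ProductApprox.marginal {i, j} σ)
            ≤ ProductApprox.errorBound d G) ∧
    (∀ Hterm : Fin n → Fin n → ProductApprox.Op n d,
      (∀ i j, (Hterm i j).IsHermitian) →
      (∀ i j, ProductApprox.opNorm (Hterm i j) ≤ 1) →
      (∀ i j, ProductApprox.ActsOnlyOn {i, j} (Hterm i j)) →
      ∀ H : ProductApprox.Op n d, H = ∑ i, ∑ j, (G i j : ℂ) • Hterm i j →
        ∃ φ : Fin n → EuclideanSpace ℂ (Fin d), (∀ k, ‖φ k‖ = 1) ∧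
          (H * ProductApprox.proj (ProductApprox.tensorVec φ)).trace.re
            ≤ ProductApprox.groundEnergy H + ProductApprox.errorBound d G) :=
  ⟨fun _ hρ => ProductApprox.exists_separable_approximation hd hρ hGsymm hGnonneg hGsum,
    fun Hterm hherm hnorm hloc H hH => by
      subst hH
      exact ProductApprox.exists_product_vector_approximation hd hGsymm hGnonneg hGsum Hterm
        hherm hnorm hloc⟩
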